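/- **Setting.** For $x\in\{-1,1\}^p$ put $T(x)=(x_sx_t)_{s,t=1}^p\in\mathbb R^{p^2}$. An Ising parameter is a vector $\theta\in\mathbb R^{p^2}$ with $\theta_{s,t}=\theta_{t,s}$ and $\theta_{s,s}=0$; the Ising model is $p(x\mid\theta)=e^{\langle\theta,T(x)\rangle}/\sum_{y}e^{\langle\theta,T(y)\rangle}$. Let $\theta_1^*,\theta_2^*$ be Ising parameters, $\delta\theta^*=\theta_1^*-\theta_2^*$, and let $x^1_1,\dots,x^1_{n_1}\sim p(\cdot\mid\theta_1^*)$ and $x^2_1,\dots,x^2_{n_2}\sim p(\cdot\mid\theta_2^*)$ be independent samples, $n_1,n_2\ge1$. Let $$\mathcal L(\delta\theta)=-\frac1{n_1}\sum_{i=1}^{n_1}\langle T(x_i^1),\delta\theta\rangle+\log\frac1{n_2}\sum_{i=1}^{n_2}e^{\langle T(x_i^2),\delta\theta\rangle},$$ and let $\delta\hat\theta$ be any minimizer of $\mathcal L(\delta\theta)+\lambda\|\delta\theta\|_1$ over the Ising parameters. For $\beta>1$ let $E_r=\{\Delta\in\mathbb R^{p^2}:\|\delta\theta^*+\Delta\|_1\le\|\delta\theta^*\|_1+\frac1\beta\|\Delta\|_1\}$,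 $C_r=\{t\Delta:t\ge0,\ \Delta\in E_r\}$ and $\Psi(C_r)=\sup_{0\ne u\in C_r}\|u\|_1/\|u\|_2$ (equal to $0$ if $C_r=\{0\}$). Let $r(x\mid\delta\theta^*)=p(x\mid\theta_1^*)/p(x\mid\theta_2^*)$. **Statement.** Let $\beta>1$ and $K,M,\kappa,a>0$. There are constants $c,\eta_1,C>0$, depending only on $\beta,K,M,\kappa,a$, such that the following holds for all $p,s$ and all Ising parameters $\theta_1^*,\theta_2^*$ satisfying * (sparsity) $\delta\theta^*$ has at most $s$ non-zero entries; * (smooth density ratio) $E_{X\sim p(\cdot\mid\theta_2^*)}\exp\{\epsilon\,(r(X\mid\delta\theta^*)-1)\}\le e^{K\epsilon^2}$ for all $\epsilon\in\mathbb R$; * (tails of the design) for all Ising parameters $u\in C_r$, $E\big[\langle u,T(X)-E\,T(X)\rangle^4\big]\le M\|u\|_2^4$ for $X\sim p(\cdot\mid\theta_2^*)$ (this holds in particular if the centred vector $T(X)$ is sub-Gaussian with a norm bounded in terms of $M$); * (restricted strong convexity of the population loss at $\delta\theta^*$, with constant $\kappa$) $\operatorname{Var}_{X\sim p(\cdot\mid\theta_1^*)}\langle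 u,T(X)\rangle\ge\kappa\|u\|_2^2$ for all Ising parameters $u\in C_r$. 1. If $\beta\ge2$, then $\Psi(C_r)\le4\sqrt s$. 2. If $n_2>c\,s\log p$, then for every $\eta\ge\eta_1$ and $\lambda=\eta\sqrt{\log p/\min(n_1,n_2)}$, with probability at least $1-p^{-a}$ every minimizer $\delta\hat\theta$ satisfies, with $\Delta=\delta\theta^*-\delta\hat\theta$, $$\|\Delta\|_2\le C\,\frac{\Psi(C_r)\,\lambda}{\kappa}\qquad\text{and}\qquad\|\Delta\|_2\le C\,\eta\,\sqrt{\frac{s\log p}{\min(n_1,n_2)}}.$$ -/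

import Mathlib

open MeasureTheory ProbabilityTheory
open scoped BigOperators

noncomputable section

/-- Spin configurations `x ∈ {-1, 1}ᵖ`. -/
abbrev Config (p : ℕ) : Type := Fin p → ℤˣ

/-- The space `ℝ^{p²}`, coordinates indexed by pairs of vertices, with the Euclidean norm. -/
abbrev PairSpace (p : ℕ) : Type := EuclideanSpace ℝ (Fin p × Fin p)

/-- The sufficient statistic `T(x) = (x_s x_t)_{s,t} ∈ ℝ^{p²}`. -/
def suffStat {p : ℕ} (x : Config p) : PairSpace p :=
  WithLp.toLp 2 (fun e => (((x e.1 : ℤ) : ℝ) * ((x e.2 : ℤ) : ℝ)))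

/-- Ising parameters: symmetric weights on unordered pairs of distinct vertices, that is, vectors
of `ℝ^{p²}` with `θ_{s,t} = θ_{t,s}` and `θ_{s,s} = 0`. -/
def isingParams (p : ℕ) : Submodule ℝ (PairSpace p) where
  carrier := {θ | (∀ s t, θ (s, t) = θ (t, s)) ∧ ∀ s, θ (s, s) = 0}
  add_mem' := by
    rintro a b ⟨ha, ha'⟩ ⟨hb, hb'⟩
    exact ⟨fun s t => by simp [ha s t, hb s t], fun s => by simp [ha' s, hb' s]⟩
  zero_mem' := by simp
  smul_mem' := by
    rintro c a ⟨ha, ha'⟩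
    exact ⟨fun s t => by simp [ha s t], fun s => by simp [ha' s]⟩

/-- The partition function `Z(θ) = ∑ₓ exp ⟨θ, T(x)⟩`. -/
def partitionFn {p : ℕ} (θ : PairSpace p) : ℝ :=
  ∑ x : Config p, Real.exp (inner ℝ θ (suffStat x))

/-- The Ising probability `p(x | θ) = exp ⟨θ, T(x)⟩ / Z(θ)`. -/
def isingProb {p : ℕ} (θ : PairSpace p) (x : Config p) : ℝ :=
  Real.exp (inner ℝ θ (suffStat x)) / partitionFn θ

/-- The expectation `E_{X ∼ p(· | θ)} [f X]` (a finite sum). -/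
def isingExp {p : ℕ} (θ : PairSpace p) (f : Config p → ℝ) : ℝ :=
  ∑ x : Config p, isingProb θ x * f x

/-- The variance of `f X` for `X ∼ p(· | θ)`. -/
def isingVar {p : ℕ} (θ : PairSpace p) (f : Config p → ℝ) : ℝ :=
  isingExp θ (fun x => (f x - isingExp θ f) ^ 2)

/-- The density ratio `r(x | δ) = exp ⟨T(x), δ⟩ / Z(δ)`, with
`Z(δ) = E_{X ∼ p(· | θ₂)} exp ⟨T(X), δ⟩`; it equals `p(x | θ₁) / p(x | θ₂)` for `δ = θ₁ - θ₂`. -/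
def densityRatio {p : ℕ} (θ₂ δ : PairSpace p) (x : Config p) : ℝ :=
  Real.exp (inner ℝ (suffStat x) δ) / isingExp θ₂ (fun y => Real.exp (inner ℝ (suffStat y) δ))

/-- Smoothness of the density ratio `r(· | δ)` at the true change `δ`: under `p(· | θ₂)` the
variable `r(X | δ) - 1` is sub-Gaussian, `E exp (ε (r - 1)) ≤ exp (K ε²)` for every real `ε`. -/
def SmoothDensityRatio {p : ℕ} (K : ℝ) (θ₂ δ : PairSpace p) : Prop :=
  ∀ ε : ℝ, isingExp θ₂ (fun x => Real.exp (ε * (densityRatio θ₂ δ x - 1))) ≤ Real.exp (K * ε ^ 2)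

/-- The `ℓ₁` norm on `ℝ^{p²}`. -/
def l1Norm {p : ℕ} (u : PairSpace p) : ℝ := ∑ e, |u e|

/-- The number of non-zero coordinates. -/
def l0Norm {p : ℕ} (u : PairSpace p) : ℕ := {e | u e ≠ 0}.ncard

/-- The error set `E_r = {Δ | R(δ + Δ) ≤ R(δ) + R(Δ) / β}` for `R = ‖·‖₁`. -/
def errorSet {p : ℕ} (β : ℝ) (δ : PairSpace p) : Set (PairSpace p) :=
  {Δ | l1Norm (δ + Δ) ≤ l1Norm δ + 1 / β * l1Norm Δ}

/-- The error cone `C_r = cone(E_r)`. -/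
def errorCone {p : ℕ} (β : ℝ) (δ : PairSpace p) : Set (PairSpace p) :=
  {u | ∃ t : ℝ, 0 ≤ t ∧ ∃ Δ ∈ errorSet β δ, u = t • Δ}

/-- The norm compatibility constant `Ψ(C) = sup_{u ∈ C} ‖u‖₁ / ‖u‖₂`. (The ratio is bounded on
`ℝ^{p²}`, and `u = 0` contributes the value `0`.) -/
def normCompat {p : ℕ} (C : Set (PairSpace p)) : ℝ :=
  sSup ((fun u => l1Norm u / ‖u‖) '' C)

/-- The empirical density-ratio loss
`L(δ) = -(1/n₁) ∑ᵢ ⟨T(x¹ᵢ), δ⟩ + log ((1/n₂) ∑ᵢ exp ⟨T(x²ᵢ), δ⟩)`. -/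
def empLoss {p n₁ n₂ : ℕ} (x₁ : Fin n₁ → Config p) (x₂ : Fin n₂ → Config p)
    (δ : PairSpace p) : ℝ :=
  -(1 / (n₁ : ℝ)) * ∑ i, inner ℝ (suffStat (x₁ i)) δ
    + Real.log (1 / (n₂ : ℝ) * ∑ i, Real.exp (inner ℝ (suffStat (x₂ i)) δ))

/-- `δ` is a minimizer of `L + lam ‖·‖₁` over the Ising parameters. -/
def IsEstimator {p n₁ n₂ : ℕ} (lam : ℝ) (x₁ : Fin n₁ → Config p) (x₂ : Fin n₂ → Config p)
    (δ : PairSpace p) : Prop :=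
  δ ∈ isingParams p ∧
    IsMinOn (fun η => empLoss x₁ x₂ η + lam * l1Norm η) (isingParams p : Set (PairSpace p)) δ

/-- `X₁`, `X₂` are two sets of i.i.d. samples, independent of each other, from the Ising models
with parameters `θ₁` and `θ₂`. -/
structure IsIsingSample {p n₁ n₂ : ℕ} {Ω : Type*} [MeasurableSpace Ω] (μ : Measure Ω)
    (θ₁ θ₂ : PairSpace p) (X₁ : Fin n₁ → Ω → Config p) (X₂ : Fin n₂ → Ω → Config p) : Prop where
  measurable₁ : ∀ i, Measurable (X₁ i)
  measurable₂ : ∀ i, Measurable (X₂ i)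
  law₁ : ∀ i x, μ.real (X₁ i ⁻¹' {x}) = isingProb θ₁ x
  law₂ : ∀ i x, μ.real (X₂ i ⁻¹' {x}) = isingProb θ₂ x
  indep : iIndepFun (Sum.elim X₁ X₂) μ

end

/-! ### Finite expectations under the Ising model -/

section Expectation

variable {p : ℕ}

/-! Write `δ = θ₁ - θ₂`, `D = δhat - δ` and `w i = r (x i) / ∑ r (x j)` on the second sample. The
loss increment from `δ` to `δ + D` is a linear term in the first sample plus the log-mgf of `⟨D, T⟩`
under `w` (`empLoss_add_sub`). Its gradient at `D = 0` is the difference of two averages of `T` that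
both concentrate around `E_{θ₁} T = E_{θ₂} [r T]`, so with high probability it is at most `lam / β`
in sup norm. Jensen's inequality then places `D` in the error set.

Curvature comes from the `w`-variance of `⟨D, T⟩`, truncated so that all summands are bounded
(`ratioWeight_growth`). At population level, moment bounds show that truncation keeps a fixed share
of the variance (`exists_truncated_lower_bound`). Uniformity over the cone comes from Maurey's
argument: on the cone `‖u‖₁ ≲ √s ‖u‖₂`, so each unit direction is close in `L²`, both empirically
and in the population, to an average of `O(s)` signed coordinates. There are `(2p²)^{O(s)}` such
averages, whence the sample size `s log p` (`truncated_rsc_of_net`).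

Truncation yields growth that is quadratic near the origin but only linear far away. The quadratic
regime gives the usual bound `Ψ lam / κ`. In the linear regime `‖D‖` is at most a multiple of `Ψ lam
‖δ‖`, and `‖δ‖` is bounded by a constant: the variance of `log r` under `θ₁` is at least `κ ‖δ‖²`,
while smoothness of `r` bounds it above (`sq_norm_le_of_isingVar`). Hence no smallness of `lam` is
needed (`norm_le_of_growth`). -/

lemma inner_suffStat (u : PairSpace p) (x : Config p) :
    inner ℝ u (suffStat x) = ∑ e, u e * suffStat x e := by
  simp [PiLp.inner_apply, mul_comm]

lemma suffStat_apply (x : Config p) (e : Fin p × Fin p) :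
    suffStat x e = ((x e.1 : ℤ) : ℝ) * ((x e.2 : ℤ) : ℝ) := rfl

lemma abs_suffStat (x : Config p) (e : Fin p × Fin p) : |suffStat x e| = 1 := by
  rw [suffStat_apply, abs_mul]
  rcases Int.units_eq_one_or (x e.1) with h | h <;> rcases Int.units_eq_one_or (x e.2) with h' | h'
    <;> simp [h, h']

lemma suffStat_diag (x : Config p) (i : Fin p) : suffStat x (i, i) = 1 := by
  rw [suffStat_apply]
  rcases Int.units_eq_one_or (x i) with h | h <;> simp [h]

lemma abs_inner_suffStat_le (u : PairSpace p) (x : Config p) :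
    |inner ℝ u (suffStat x)| ≤ l1Norm u := by
  rw [inner_suffStat]
  refine (Finset.abs_sum_le_sum_abs _ _).trans (Finset.sum_le_sum fun e _ => ?_)
  rw [abs_mul, abs_suffStat, mul_one]

lemma partitionFn_pos (θ : PairSpace p) : 0 < partitionFn θ :=
  Finset.sum_pos (fun _ _ => Real.exp_pos _) Finset.univ_nonempty

lemma isingProb_pos (θ : PairSpace p) (x : Config p) : 0 < isingProb θ x :=
  div_pos (Real.exp_pos _) (partitionFn_pos θ)

lemma sum_isingProb (θ : PairSpace p) : ∑ x, isingProb θ x = 1 := by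
  simp only [isingProb, ← Finset.sum_div]
  exact div_self (partitionFn_pos θ).ne'

lemma isingExp_const (θ : PairSpace p) (c : ℝ) : isingExp θ (fun _ => c) = c := by
  rw [isingExp, ← Finset.sum_mul, sum_isingProb, one_mul]

lemma isingExp_mono (θ : PairSpace p) {f g : Config p → ℝ} (h : ∀ x, f x ≤ g x) :
    isingExp θ f ≤ isingExp θ g :=
  Finset.sum_le_sum fun x _ => mul_le_mul_of_nonneg_left (h x) (isingProb_pos θ x).le

lemma isingExp_nonneg (θ : PairSpace p) {f : Config p → ℝ} (h : ∀ x, 0 ≤ f x) :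
    0 ≤ isingExp θ f :=
  Finset.sum_nonneg fun x _ => mul_nonneg (isingProb_pos θ x).le (h x)

lemma isingExp_add (θ : PairSpace p) (f g : Config p → ℝ) :
    isingExp θ (fun x => f x + g x) = isingExp θ f + isingExp θ g := by
  simp only [isingExp, mul_add, Finset.sum_add_distrib]

lemma isingExp_sub (θ : PairSpace p) (f g : Config p → ℝ) :
    isingExp θ (fun x => f x - g x) = isingExp θ f - isingExp θ g := by
  simp only [isingExp, mul_sub, Finset.sum_sub_distrib]

lemma isingExp_const_mul (θ : PairSpace p) (c : ℝ) (f : Config p → ℝ) :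
    isingExp θ (fun x => c * f x) = c * isingExp θ f := by
  simp only [isingExp, Finset.mul_sum]
  exact Finset.sum_congr rfl fun x _ => by ring

lemma isingVar_le (θ : PairSpace p) (f : Config p → ℝ) (m : ℝ) :
    isingVar θ f ≤ isingExp θ (fun x => (f x - m) ^ 2) := by
  have h : isingExp θ (fun x => (f x - m) ^ 2)
      = isingVar θ f + (isingExp θ f - m) ^ 2 := by
    set e := isingExp θ f with he
    have h1 : (fun x => (f x - m) ^ 2)
        = fun x => (f x - e) ^ 2 + (2 * (e - m) * (f x - e) + (e - m) ^ 2) := by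
      funext x; ring
    rw [h1, isingExp_add, isingExp_add, isingExp_const_mul, isingExp_sub, isingExp_const,
      isingExp_const, ← he, isingVar, ← he]
    ring
  rw [h]
  nlinarith [sq_nonneg (isingExp θ f - m)]

end Expectation

/-! ### Change of measure and the size of the true change -/

section DensityRatio

variable {p : ℕ}

lemma isingExp_exp_pos (θ : PairSpace p) (f : Config p → ℝ) :
    0 < isingExp θ (fun x => Real.exp (f x)) :=
  Finset.sum_pos (fun x _ => mul_pos (isingProb_pos θ x) (Real.exp_pos _)) Finset.univ_nonempty

lemma densityRatio_pos (θ δ : PairSpace p) (x : Config p) : 0 < densityRatio θ δ x :=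
  div_pos (Real.exp_pos _) (isingExp_exp_pos _ _)

lemma isingProb_mul_densityRatio (θ₁ θ₂ : PairSpace p) (x : Config p) :
    isingProb θ₂ x * densityRatio θ₂ (θ₁ - θ₂) x = isingProb θ₁ x := by
  have key : ∀ y, Real.exp (inner ℝ θ₂ (suffStat y))
      * Real.exp (inner ℝ (suffStat y) (θ₁ - θ₂)) = Real.exp (inner ℝ θ₁ (suffStat y)) := by
    intro y
    rw [← Real.exp_add, inner_sub_right, real_inner_comm θ₁, real_inner_comm θ₂]
    congr 1; ring
  have hZ : isingExp θ₂ (fun y => Real.exp (inner ℝ (suffStat y) (θ₁ - θ₂)))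
      = partitionFn θ₁ / partitionFn θ₂ := by
    simp only [isingExp, isingProb, div_mul_eq_mul_div, key, ← Finset.sum_div]
    rfl
  rw [densityRatio, hZ, isingProb, isingProb, ← key x]
  have h1 := (partitionFn_pos θ₁).ne'
  have h2 := (partitionFn_pos θ₂).ne'
  field_simp

lemma isingExp_densityRatio_mul (θ₁ θ₂ : PairSpace p) (f : Config p → ℝ) :
    isingExp θ₂ (fun x => densityRatio θ₂ (θ₁ - θ₂) x * f x) = isingExp θ₁ f := by
  simp only [isingExp, ← mul_assoc, isingProb_mul_densityRatio]

lemma isingExp_densityRatio (θ₁ θ₂ : PairSpace p) :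
    isingExp θ₂ (densityRatio θ₂ (θ₁ - θ₂)) = 1 := by
  have := isingExp_densityRatio_mul θ₁ θ₂ (fun _ => 1)
  simpa [isingExp_const] using this

lemma SmoothDensityRatio.exp_mul_le {K : ℝ} {θ δ : PairSpace p} (h : SmoothDensityRatio K θ δ)
    (ε : ℝ) : isingExp θ (fun x => Real.exp (ε * densityRatio θ δ x))
      ≤ Real.exp (K * ε ^ 2 + ε) := by
  have h1 : (fun x => Real.exp (ε * densityRatio θ δ x))
      = fun x => Real.exp ε * Real.exp (ε * (densityRatio θ δ x - 1)) := by
    funext x; rw [← Real.exp_add]; congr 1; ring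
  rw [h1, isingExp_const_mul, add_comm, Real.exp_add]
  exact mul_le_mul_of_nonneg_left (h ε) (Real.exp_pos _).le

lemma mul_sq_log_le {r : ℝ} (hr : 0 < r) : r * Real.log r ^ 2 ≤ 4 + r ^ 2 := by
  obtain ⟨y, hy, rfl⟩ : ∃ y : ℝ, 0 < y ∧ r = y ^ 2 :=
    ⟨√r, Real.sqrt_pos.2 hr, (Real.sq_sqrt hr.le).symm⟩
  -- With `r = y²` the left side is `4 (y log y)²`: below 1 use `|y log y| < 1`, above 1 use `log y
  -- ≤ y / 2`.
  have hl : Real.log (y ^ 2) = 2 * Real.log y := by rw [Real.log_pow]; norm_num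
  rw [hl]
  rcases le_total y 1 with h1 | h1
  · have := abs_lt.1 (Real.abs_log_mul_self_lt y hy h1)
    nlinarith [sq_nonneg (y ^ 2)]
  · have h2 := Real.log_le_sub_one_of_pos (half_pos hy)
    rw [Real.log_div hy.ne' two_ne_zero] at h2
    have h3 : Real.log y ≤ y / 2 := by linarith [Real.log_two_lt_d9]
    have h4 : 0 ≤ Real.log y := Real.log_nonneg h1
    have h5 : Real.log y ^ 2 ≤ (y / 2) ^ 2 := pow_le_pow_left₀ h4 h3 2
    nlinarith [mul_le_mul_of_nonneg_left h5 (sq_nonneg y)]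

/-- The change `δ` is bounded in Euclidean norm when the log density ratio has non-degenerate
variance. -/
lemma sq_norm_le_of_isingVar {K κ : ℝ} (θ₁ θ₂ : PairSpace p)
    (hs : SmoothDensityRatio K θ₂ (θ₁ - θ₂))
    (hv : κ * ‖θ₁ - θ₂‖ ^ 2 ≤ isingVar θ₁ (fun x => inner ℝ (θ₁ - θ₂) (suffStat x))) :
    κ * ‖θ₁ - θ₂‖ ^ 2 ≤ 4 + 2 * Real.exp (K + 1) := by
  set δ := θ₁ - θ₂ with hδ
  set r := densityRatio θ₂ δ with hr
  set Z := isingExp θ₂ (fun y => Real.exp (inner ℝ (suffStat y) δ)) with hZ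
  have hlog : ∀ x, Real.log (r x) = inner ℝ δ (suffStat x) - Real.log Z := by
    intro x
    rw [hr, densityRatio, Real.log_div (Real.exp_pos _).ne' (isingExp_exp_pos _ _).ne',
      Real.log_exp, real_inner_comm]
  -- Centring at `log Z` instead of the mean turns the bound into `E_{θ₁} log² r = E_{θ₂} [r log²
  -- r]`, which exponential moments of `r` control.
  refine hv.trans ((isingVar_le _ _ (Real.log Z)).trans ?_)
  simp only [← hlog]
  rw [← isingExp_densityRatio_mul θ₁ θ₂]
  have h2 : ∀ x, r x * Real.log (r x) ^ 2 ≤ 4 + 2 * Real.exp (1 * r x) := by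
    intro x
    have h0 : 0 < r x := densityRatio_pos _ _ _
    have := Real.quadratic_le_exp_of_nonneg h0.le
    have := mul_sq_log_le h0
    rw [one_mul]
    nlinarith
  refine (isingExp_mono θ₂ h2).trans ?_
  rw [isingExp_add, isingExp_const, isingExp_const_mul]
  have := hs.exp_mul_le 1
  simp only [one_pow, mul_one] at this
  linarith

end DensityRatio

/-! ### Exponential deviation bounds for i.i.d. Ising samples -/

section Chernoff

variable {p : ℕ}

lemma measurableSingletonClass_intUnits : MeasurableSingletonClass ℤˣ where
  measurableSet_singleton u := ⟨{(u : ℤ)}, measurableSet_singleton _, by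
    ext v; simp [Units.ext_iff]⟩

lemma measurable_of_config {α : Type*} [MeasurableSpace α] (f : Config p → α) : Measurable f := by
  have := measurableSingletonClass_intUnits
  exact measurable_of_finite f

lemma integral_comp_eq_isingExp {Ω : Type*} [MeasurableSpace Ω] {μ : Measure Ω}
    [IsProbabilityMeasure μ] {θ : PairSpace p} {X : Ω → Config p} (hX : Measurable X)
    (hl : ∀ x, μ.real (X ⁻¹' {x}) = isingProb θ x) (f : Config p → ℝ) :
    ∫ ω, f (X ω) ∂μ = isingExp θ f := by
  have := measurableSingletonClass_intUnits
  have : IsProbabilityMeasure (μ.map X) := Measure.isProbabilityMeasure_map hX.aemeasurable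
  rw [← integral_map (f := f) hX.aemeasurable (measurable_of_config f).aestronglyMeasurable,
    integral_fintype Integrable.of_finite, isingExp]
  refine Finset.sum_congr rfl fun x _ => ?_
  rw [map_measureReal_apply hX (measurableSet_singleton x), hl, smul_eq_mul]

/-- Chernoff's bound for a sum over an i.i.d. Ising sample. -/
lemma measureReal_sum_nonneg_le {Ω : Type*} [MeasurableSpace Ω] {μ : Measure Ω}
    [IsProbabilityMeasure μ] {θ : PairSpace p} {n : ℕ} {X : Fin n → Ω → Config p}
    (hX : ∀ i, Measurable (X i)) (hl : ∀ i x, μ.real (X i ⁻¹' {x}) = isingProb θ x)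
    (hi : iIndepFun X μ) {f : Config p → ℝ} {ε b : ℝ} (hε : 0 ≤ ε)
    (hb : isingExp θ (fun x => Real.exp (ε * f x)) ≤ Real.exp b) :
    μ.real {ω | 0 ≤ ∑ i, f (X i ω)} ≤ Real.exp (n * b) := by
  set Y : Fin n → Ω → ℝ := fun i ω => f (X i ω) with hY
  have hYm : ∀ i, Measurable (Y i) := fun i => (measurable_of_config f).comp (hX i)
  have hYi : iIndepFun Y μ := hi.comp (fun _ => f) fun _ => measurable_of_config f
  have hfin : ∃ B, ∀ x, f x ≤ B := by
    obtain ⟨B, hB⟩ := (Set.finite_range f).bddAbove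
    exact ⟨B, fun x => hB ⟨x, rfl⟩⟩
  obtain ⟨B, hB⟩ := hfin
  have hint : Integrable (fun ω => Real.exp (ε * (∑ i, Y i) ω)) μ := by
    refine Integrable.of_bound (C := Real.exp (ε * (n * B)))
      (by fun_prop) (Filter.Eventually.of_forall fun ω => ?_)
    rw [Real.norm_eq_abs, abs_of_pos (Real.exp_pos _), Finset.sum_apply]
    refine Real.exp_le_exp.2 (mul_le_mul_of_nonneg_left ?_ hε)
    refine (Finset.sum_le_sum fun i _ => hB (X i ω)).trans ?_
    simp
  have h := measure_ge_le_exp_mul_mgf (μ := μ) (X := ∑ i, Y i) 0 hε hint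
  rw [hYi.mgf_sum hYm, mul_zero, Real.exp_zero, one_mul] at h
  have h1 : ∀ i, mgf (Y i) μ ε ≤ Real.exp b := by
    intro i
    rw [mgf, integral_comp_eq_isingExp (hX i) (hl i) (fun x => Real.exp (ε * f x))]
    exact hb
  have h2 : ∏ i, mgf (Y i) μ ε ≤ Real.exp (n * b) := by
    refine (Finset.prod_le_prod (fun i _ => mgf_nonneg) fun i _ => h1 i).trans ?_
    simp [← Real.exp_nat_mul]
  refine le_trans (le_of_eq ?_) (h.trans h2)
  congr 1
  ext ω
  simp [hY, Finset.sum_apply]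

lemma exp_le_one_add_add_sq_mul_exp_abs (y : ℝ) :
    Real.exp y ≤ 1 + y + y ^ 2 * Real.exp |y| := by
  have h := Complex.norm_exp_sub_sum_le_norm_mul_exp (y : ℂ) 2
  have h1 : Complex.exp y - ∑ m ∈ Finset.range 2, (y : ℂ) ^ m / (m.factorial : ℂ)
      = ((Real.exp y - (1 + y) : ℝ) : ℂ) := by
    simp [Finset.sum_range_succ]
  rw [h1, Complex.norm_real, Complex.norm_real, Real.norm_eq_abs, Real.norm_eq_abs, sq_abs] at h
  linarith [(abs_le.1 h).2]

/-- Expand to second order: the linear term vanishes by centring, and `Y² ≤ 2 exp |Y|` absorbs the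
quadratic term into the exponential moment at 2. Restricting to `ε ≤ 1` keeps the remainder within
that moment. -/
lemma isingExp_exp_le {θ : PairSpace p} {Y : Config p → ℝ} {A ε : ℝ}
    (h0 : isingExp θ Y = 0) (hA : 2 * isingExp θ (fun x => Real.exp (2 * |Y x|)) ≤ A)
    (hε : 0 ≤ ε) (hε1 : ε ≤ 1) :
    isingExp θ (fun x => Real.exp (ε * Y x)) ≤ Real.exp (A * ε ^ 2) := by
  have h1 : ∀ x, Real.exp (ε * Y x) ≤ 1 + (ε * Y x + ε ^ 2 * 2 * Real.exp (2 * |Y x|)) := by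
    intro x
    have h2 := exp_le_one_add_add_sq_mul_exp_abs (ε * Y x)
    have h3 : Real.exp |ε * Y x| ≤ Real.exp |Y x| := by
      rw [Real.exp_le_exp, abs_mul, abs_of_nonneg hε]
      exact mul_le_of_le_one_left (abs_nonneg _) hε1
    have h4 : Y x ^ 2 ≤ 2 * Real.exp |Y x| := by
      have := Real.quadratic_le_exp_of_nonneg (abs_nonneg (Y x))
      have := abs_nonneg (Y x)
      have := sq_abs (Y x)
      linarith
    have h5 : Real.exp (2 * |Y x|) = Real.exp |Y x| * Real.exp |Y x| := by
      rw [← Real.exp_add]; congr 1; ring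
    have h6 : Y x ^ 2 * Real.exp |ε * Y x| ≤ 2 * Real.exp |Y x| * Real.exp |Y x| :=
      mul_le_mul h4 h3 (Real.exp_pos _).le (by positivity)
    have h7 := mul_le_mul_of_nonneg_left h6 (sq_nonneg ε)
    rw [h5]
    nlinarith
  refine (isingExp_mono θ h1).trans ?_
  rw [isingExp_add, isingExp_add, isingExp_const, isingExp_const_mul, isingExp_const_mul, h0]
  have h8 := Real.add_one_le_exp (A * ε ^ 2)
  nlinarith [sq_nonneg ε]

/-- A one-sided Bernstein-type deviation bound. -/
lemma measureReal_sum_sub_nonneg_le {Ω : Type*} [MeasurableSpace Ω] {μ : Measure Ω}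
    [IsProbabilityMeasure μ] {θ : PairSpace p} {n : ℕ} {X : Fin n → Ω → Config p}
    (hX : ∀ i, Measurable (X i)) (hl : ∀ i x, μ.real (X i ⁻¹' {x}) = isingProb θ x)
    (hi : iIndepFun X μ) {Y : Config p → ℝ} {A t : ℝ} (h0 : isingExp θ Y = 0)
    (hA : 2 * isingExp θ (fun x => Real.exp (2 * |Y x|)) ≤ A) (hA0 : 0 < A)
    (ht : 0 ≤ t) (htA : t ≤ 2 * A) :
    μ.real {ω | 0 ≤ ∑ i, (Y (X i ω) - t)} ≤ Real.exp (-(n * t ^ 2 / (4 * A))) := by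
  -- `ε = t / (2A)` minimizes `A ε² - ε t`; the hypothesis `t ≤ 2A` is what keeps it at most 1.
  have hε : 0 ≤ t / (2 * A) := by positivity
  have hε1 : t / (2 * A) ≤ 1 := (div_le_one (by positivity)).2 htA
  have h := measureReal_sum_nonneg_le hX hl hi (f := fun x => Y x - t)
    (b := -(t ^ 2 / (4 * A))) hε ?_
  · refine h.trans (le_of_eq ?_)
    congr 1; ring
  · have h1 : (fun x => Real.exp (t / (2 * A) * (Y x - t)))
        = fun x => Real.exp (-(t / (2 * A) * t)) * Real.exp (t / (2 * A) * Y x) := by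
      funext x; rw [← Real.exp_add]; congr 1; ring
    rw [h1, isingExp_const_mul]
    refine (mul_le_mul_of_nonneg_left (isingExp_exp_le h0 hA hε hε1) (Real.exp_pos _).le).trans ?_
    rw [← Real.exp_add]
    refine Real.exp_le_exp.2 (le_of_eq ?_)
    field_simp
    ring

end Chernoff

/-! ### Geometry of the error cone -/

section Cone

variable {p : ℕ}

lemma l1Norm_nonneg (u : PairSpace p) : 0 ≤ l1Norm u := Finset.sum_nonneg fun _ _ => abs_nonneg _

lemma l1Norm_smul (t : ℝ) (u : PairSpace p) : l1Norm (t • u) = |t| * l1Norm u := by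
  simp [l1Norm, abs_mul, Finset.mul_sum]

lemma l1Norm_neg (u : PairSpace p) : l1Norm (-u) = l1Norm u := by
  simp [l1Norm]

lemma l1Norm_add_le (u v : PairSpace p) : l1Norm (u + v) ≤ l1Norm u + l1Norm v := by
  rw [l1Norm, l1Norm, l1Norm, ← Finset.sum_add_distrib]
  exact Finset.sum_le_sum fun e _ => abs_add_le _ _

lemma sum_abs_le_sqrt_mul_norm (S : Finset (Fin p × Fin p)) (u : PairSpace p) :
    ∑ e ∈ S, |u e| ≤ √(S.card : ℝ) * ‖u‖ := by
  have h1 : (∑ e ∈ S, |u e|) ^ 2 ≤ S.card * ‖u‖ ^ 2 := by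
    refine (sq_sum_le_card_mul_sum_sq).trans (mul_le_mul_of_nonneg_left ?_ (Nat.cast_nonneg _))
    rw [EuclideanSpace.norm_sq_eq]
    simp only [sq_abs, Real.norm_eq_abs]
    exact Finset.sum_le_univ_sum_of_nonneg fun e => sq_nonneg _
  refine abs_le_of_sq_le_sq' ?_ (by positivity) |>.2
  rwa [mul_pow, Real.sq_sqrt (Nat.cast_nonneg _)]

/-- Off the support `S` of `δ` the coordinates of `Δ` add fully to the norm; on `S` the triangle
inequality loses at most `2 |Δ e|`. So `‖Δ‖₁` is controlled by its part on `S`, where Cauchy–Schwarz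
gives `√s`. -/
lemma errorSet_l1Norm_le {β : ℝ} {δ Δ : PairSpace p} {s : ℕ} (hs : l0Norm δ ≤ s)
    (h : Δ ∈ errorSet β δ) : (1 - 1 / β) * l1Norm Δ ≤ 2 * √(s : ℝ) * ‖Δ‖ := by
  classical
  set S : Finset (Fin p × Fin p) := Finset.univ.filter fun e => δ e ≠ 0 with hS
  have hcard : S.card ≤ s := by
    refine le_trans (le_of_eq ?_) hs
    rw [l0Norm, ← Set.ncard_coe_finset]
    congr 1
    ext e; simp [hS]
  have h1 : l1Norm δ + l1Norm Δ - 2 * ∑ e ∈ S, |Δ e| ≤ l1Norm (δ + Δ) := by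
    rw [hS, Finset.sum_filter, l1Norm, l1Norm, l1Norm, Finset.mul_sum, ← Finset.sum_add_distrib,
      ← Finset.sum_sub_distrib]
    refine Finset.sum_le_sum fun e _ => ?_
    by_cases he : δ e = 0
    · simp [he]
    · simp only [ne_eq, he, not_false_eq_true, if_true, PiLp.add_apply]
      have := abs_sub_abs_le_abs_add (δ e) (Δ e)
      linarith
  have h2 : ∑ e ∈ S, |Δ e| ≤ √(s : ℝ) * ‖Δ‖ :=
    (sum_abs_le_sqrt_mul_norm S Δ).trans (mul_le_mul_of_nonneg_right
      (Real.sqrt_le_sqrt (by exact_mod_cast hcard)) (norm_nonneg _))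
  have h3 : l1Norm (δ + Δ) ≤ l1Norm δ + 1 / β * l1Norm Δ := h
  linarith

lemma errorCone_l1Norm_le {β : ℝ} {δ u : PairSpace p} {s : ℕ} (hs : l0Norm δ ≤ s)
    (h : u ∈ errorCone β δ) : (1 - 1 / β) * l1Norm u ≤ 2 * √(s : ℝ) * ‖u‖ := by
  obtain ⟨t, ht, Δ, hΔ, rfl⟩ := h
  rw [l1Norm_smul, norm_smul, Real.norm_eq_abs]
  nlinarith [mul_le_mul_of_nonneg_left (errorSet_l1Norm_le hs hΔ) (abs_nonneg t)]

/-- Elements of the error cone satisfy `‖u‖₁ ≤ 2 β / (β - 1) √s ‖u‖₂`. -/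
lemma l1Norm_le_of_mem_errorCone {β : ℝ} (hβ : 1 < β) {δ u : PairSpace p} {s : ℕ}
    (hs : l0Norm δ ≤ s) (h : u ∈ errorCone β δ) :
    l1Norm u ≤ 2 * β / (β - 1) * √(s : ℝ) * ‖u‖ := by
  have h1 := errorCone_l1Norm_le hs h
  have h2 : 1 - 1 / β = (β - 1) / β := by field_simp
  rw [h2, div_mul_eq_mul_div, div_le_iff₀ (by linarith)] at h1
  rw [mul_assoc, div_mul_eq_mul_div, le_div_iff₀ (by linarith)]
  nlinarith

lemma l1Norm_div_norm_le {β : ℝ} (hβ : 1 < β) {δ u : PairSpace p} {s : ℕ}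
    (hs : l0Norm δ ≤ s) (h : u ∈ errorCone β δ) :
    l1Norm u / ‖u‖ ≤ 2 * β / (β - 1) * √(s : ℝ) := by
  have hb : 0 ≤ 2 * β / (β - 1) := div_nonneg (by linarith) (by linarith)
  exact div_le_of_le_mul₀ (norm_nonneg _) (by positivity) (l1Norm_le_of_mem_errorCone hβ hs h)

lemma normCompat_errorCone_le {β : ℝ} (hβ : 1 < β) {δ : PairSpace p} {s : ℕ}
    (hs : l0Norm δ ≤ s) : normCompat (errorCone β δ) ≤ 2 * β / (β - 1) * √(s : ℝ) := by
  have hb : 0 ≤ 2 * β / (β - 1) := div_nonneg (by linarith) (by linarith)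
  refine Real.sSup_le ?_ (by positivity)
  rintro _ ⟨u, hu, rfl⟩
  exact l1Norm_div_norm_le hβ hs hu

lemma normCompat_nonneg (C : Set (PairSpace p)) : 0 ≤ normCompat C := by
  refine Real.sSup_nonneg ?_
  rintro _ ⟨u, -, rfl⟩
  exact div_nonneg (l1Norm_nonneg u) (norm_nonneg u)

lemma l1Norm_le_normCompat_mul {β : ℝ} (hβ : 1 < β) {δ u : PairSpace p}
    (h : u ∈ errorCone β δ) : l1Norm u ≤ normCompat (errorCone β δ) * ‖u‖ := by
  rcases eq_or_ne u 0 with rfl | hu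
  · simp [l1Norm]
  · rw [← div_le_iff₀ (norm_pos_iff.2 hu)]
    refine le_csSup ⟨2 * β / (β - 1) * √(l0Norm δ : ℝ), ?_⟩ ⟨u, h, rfl⟩
    rintro _ ⟨v, hv, rfl⟩
    exact l1Norm_div_norm_le hβ le_rfl hv

lemma mem_errorCone_of_mem_errorSet {β : ℝ} {δ Δ : PairSpace p} (h : Δ ∈ errorSet β δ) :
    Δ ∈ errorCone β δ := ⟨1, zero_le_one, Δ, h, (one_smul _ _).symm⟩

lemma smul_mem_errorCone {β t : ℝ} (ht : 0 ≤ t) {δ u : PairSpace p} (h : u ∈ errorCone β δ) :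
    t • u ∈ errorCone β δ := by
  obtain ⟨t', ht', Δ, hΔ, rfl⟩ := h
  exact ⟨t * t', mul_nonneg ht ht', Δ, hΔ, smul_smul _ _ _⟩

/-- This is the error of the zero estimate. It makes the compatibility constant and the curvature
hypothesis available for `δ` itself. -/
lemma neg_mem_errorSet {β : ℝ} (hβ : 0 ≤ β) (δ : PairSpace p) : -δ ∈ errorSet β δ := by
  have h0 : l1Norm (0 : PairSpace p) = 0 := by simp [l1Norm]
  have : 0 ≤ l1Norm δ + 1 / β * l1Norm (-δ) :=
    add_nonneg (l1Norm_nonneg _) (mul_nonneg (by positivity) (l1Norm_nonneg _))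
  simpa [errorSet, h0] using this

/-- An error vector is bounded in `ℓ₁` by a multiple of the true change. -/
lemma errorSet_l1Norm_le_mul {β : ℝ} (hβ : 1 < β) {δ Δ : PairSpace p} (h : Δ ∈ errorSet β δ) :
    l1Norm Δ ≤ 2 * β / (β - 1) * l1Norm δ := by
  have h3 : l1Norm (δ + Δ) ≤ l1Norm δ + 1 / β * l1Norm Δ := h
  have h4 : l1Norm Δ ≤ l1Norm (δ + Δ) + l1Norm δ := by
    have := l1Norm_add_le (δ + Δ) (-δ)
    rwa [l1Norm_neg, add_neg_cancel_comm] at this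
  have h5 : (1 - 1 / β) * l1Norm Δ ≤ 2 * l1Norm δ := by linarith
  have h2 : 1 - 1 / β = (β - 1) / β := by field_simp
  rw [h2, div_mul_eq_mul_div, div_le_iff₀ (by linarith)] at h5
  rw [div_mul_eq_mul_div, le_div_iff₀ (by linarith)]
  nlinarith

end Cone

/-! ### Lower bounds for the log-partition function -/

section LogSumExp

lemma one_add_add_min_sq_le_exp (h : ℝ) : 1 + h + min (h ^ 2) 1 / 4 ≤ Real.exp h := by
  rcases le_total 0 h with h0 | h0
  · have := Real.quadratic_le_exp_of_nonneg h0
    have := min_le_left (h ^ 2) 1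
    nlinarith [sq_nonneg h]
  rcases le_total (-1) h with h1 | h1
  · have h2 := Real.exp_bound (x := h) (by rw [abs_le]; constructor <;> linarith)
      (n := 3) (by norm_num)
    simp only [Finset.sum_range_succ, Finset.sum_range_zero, Nat.factorial] at h2
    norm_num at h2
    have h3 : |h| ^ 3 ≤ h ^ 2 := by
      rw [abs_of_nonpos h0]; nlinarith [sq_nonneg h]
    have := min_le_left (h ^ 2) 1
    have := (abs_le.1 h2).1
    nlinarith [sq_nonneg h]
  -- For `h ≤ -1` the tangent line of `exp` at `-1` already suffices.
  · have := min_le_right (h ^ 2) 1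
    have h2 : Real.exp h = Real.exp (-1) * Real.exp (h + 1) := by
      rw [← Real.exp_add]; congr 1; ring
    have h3 := Real.add_one_le_exp (h + 1)
    have h4 := Real.exp_neg_one_gt_d9
    have h5 := Real.exp_neg_one_lt_d9
    have h6 := mul_le_mul_of_nonneg_left h3 (Real.exp_pos (-1)).le
    rw [h2]
    nlinarith

variable {ι : Type*} [Fintype ι]

/-- Averaging the pointwise bound kills the linear term, leaving `1 + S / 4`; since `S ≤ 1`, the
logarithm of this is at least `S / 8`. -/
lemma log_sum_mul_exp_ge (w h : ι → ℝ) (hw : ∀ i, 0 ≤ w i) (hw1 : ∑ i, w i = 1)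
    (h0 : ∑ i, w i * h i = 0) :
    (∑ i, w i * min (h i ^ 2) 1) / 8 ≤ Real.log (∑ i, w i * Real.exp (h i)) := by
  set S := ∑ i, w i * min (h i ^ 2) 1 with hS
  have hS0 : 0 ≤ S := Finset.sum_nonneg fun i _ => mul_nonneg (hw i) (by positivity)
  have hS1 : S ≤ 1 := by
    rw [← hw1]
    exact Finset.sum_le_sum fun i _ => mul_le_of_le_one_right (hw i) (min_le_right _ _)
  have h1 : 1 + S / 4 ≤ ∑ i, w i * Real.exp (h i) := by
    calc 1 + S / 4 = ∑ i, w i * (1 + h i + min (h i ^ 2) 1 / 4) := by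
          simp only [mul_add, Finset.sum_add_distrib, mul_one, hw1, h0, mul_div_assoc', hS,
            Finset.sum_div, add_zero]
      _ ≤ _ := Finset.sum_le_sum fun i _ =>
          mul_le_mul_of_nonneg_left (one_add_add_min_sq_le_exp (h i)) (hw i)
  refine le_trans ?_ (Real.log_le_log (by linarith) h1)
  have h2 := Real.one_sub_inv_le_log_of_pos (x := 1 + S / 4) (by linarith)
  refine le_trans ?_ h2
  rw [← sub_nonneg]
  have h3 : 1 - (1 + S / 4)⁻¹ - S / 8 = S * (4 - S) / (8 * (4 + S)) := by
    have : (4 : ℝ) + S ≠ 0 := by linarith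
    have : 1 + S / 4 ≠ 0 := by linarith
    field_simp
    ring
  rw [h3]
  exact div_nonneg (mul_nonneg hS0 (by linarith)) (by linarith)

lemma sum_mul_le_log_sum_mul_exp (w y : ι → ℝ) (hw : ∀ i, 0 ≤ w i) (hw1 : ∑ i, w i = 1) :
    ∑ i, w i * y i ≤ Real.log (∑ i, w i * Real.exp (y i)) := by
  have h := convexOn_exp.map_sum_le (t := Finset.univ) (w := w) (p := y) (fun i _ => hw i) hw1
    (fun i _ => Set.mem_univ _)
  simp only [smul_eq_mul] at h
  rwa [Real.le_log_iff_exp_le ((Real.exp_pos _).trans_le h)]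

/-- Growth of the log-partition function of a weighted sample along a ray: quadratic near the
origin and linear afterwards. -/
lemma log_sum_mul_exp_growth (w v : ι → ℝ) (hw : ∀ i, 0 ≤ w i) (hw1 : ∑ i, w i = 1)
    {κ τ t : ℝ} (hκ : 0 ≤ κ) (hτ : 0 < τ) (ht : 0 < t)
    (hv : κ ≤ ∑ i, w i * min ((v i - ∑ j, w j * v j) ^ 2) (τ ^ 2)) :
    κ / 8 * min (t ^ 2) (t / τ) ≤
      Real.log (∑ i, w i * Real.exp (t * v i)) - t * ∑ i, w i * v i := by
  set m := ∑ i, w i * v i with hm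
  have hpos : ∀ f : ι → ℝ, 0 < ∑ i, w i * Real.exp (f i) := by
    intro f
    obtain ⟨i, -, hi⟩ : ∃ i ∈ Finset.univ, 0 < w i := by
      by_contra! h
      have := Finset.sum_nonpos h
      linarith
    exact Finset.sum_pos' (fun i _ => mul_nonneg (hw i) (Real.exp_pos _).le)
      ⟨i, Finset.mem_univ _, mul_pos hi (Real.exp_pos _)⟩
  have hcen : ∀ r : ℝ, Real.log (∑ i, w i * Real.exp (r * v i)) - r * m
      = Real.log (∑ i, w i * Real.exp (r * (v i - m))) := by
    intro r
    have h1 : ∑ i, w i * Real.exp (r * (v i - m))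
        = (∑ i, w i * Real.exp (r * v i)) * Real.exp (-(r * m)) := by
      rw [Finset.sum_mul]
      refine Finset.sum_congr rfl fun i _ => ?_
      rw [mul_assoc, ← Real.exp_add]; congr 2; ring
    rw [h1, Real.log_mul (hpos _).ne' (Real.exp_pos _).ne', Real.log_exp]; ring
  -- While `r τ ≤ 1`, truncating `v - m` at `τ` and rescaling by `r` truncates at a level below 1,
  -- so the centred estimate applies.
  have hsmall : ∀ r : ℝ, 0 < r → r * τ ≤ 1 →
      κ / 8 * r ^ 2 ≤ Real.log (∑ i, w i * Real.exp (r * (v i - m))) := by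
    intro r hr hrτ
    have h0 : ∑ i, w i * (r * (v i - m)) = 0 := by
      have : ∀ i, w i * (r * (v i - m)) = r * (w i * v i) - r * m * w i := fun i => by ring
      simp only [this, Finset.sum_sub_distrib, ← Finset.mul_sum, hw1, ← hm]
      ring
    refine le_trans ?_ (log_sum_mul_exp_ge w _ hw hw1 h0)
    have h1 : κ * r ^ 2 ≤ ∑ i, w i * min ((r * (v i - m)) ^ 2) 1 := by
      refine (mul_le_mul_of_nonneg_right hv (sq_nonneg r)).trans ?_
      rw [Finset.sum_mul]
      refine Finset.sum_le_sum fun i _ => ?_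
      rw [mul_assoc]
      refine mul_le_mul_of_nonneg_left (le_min ?_ ?_) (hw i)
      · rw [mul_pow, mul_comm]
        exact mul_le_mul_of_nonneg_left (min_le_left _ _) (sq_nonneg r)
      · refine (mul_le_mul_of_nonneg_right (min_le_right _ _) (sq_nonneg r)).trans ?_
        have : (r * τ) ^ 2 ≤ 1 := pow_le_one₀ (by positivity) hrτ
        nlinarith
    linarith
  rw [hcen]
  rcases le_total (t * τ) 1 with h | h
  · exact (mul_le_mul_of_nonneg_left (min_le_left _ _) (by positivity)).trans (hsmall t ht h)
  · have h1 := hsmall τ⁻¹ (inv_pos.2 hτ) (by rw [inv_mul_cancel₀ hτ.ne'])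
    -- Beyond `1 / τ`, the power-mean inequality with exponent `t τ ≥ 1` propagates the value at `1
    -- / τ` linearly in `t`.
    have h2 := Real.rpow_arith_mean_le_arith_mean_rpow Finset.univ w
      (fun i => Real.exp (τ⁻¹ * (v i - m))) (fun i _ => hw i) hw1 (fun i _ => (Real.exp_pos _).le) h
    simp only [← Real.exp_mul] at h2
    have h3 := Real.log_le_log (Real.rpow_pos_of_pos (hpos _) _) h2
    rw [Real.log_rpow (hpos _)] at h3
    have h4 : ∀ i, τ⁻¹ * (v i - m) * (t * τ) = t * (v i - m) := fun i => by field_simp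
    simp only [h4] at h3
    refine le_trans ?_ h3
    have h5 := mul_le_mul_of_nonneg_left h1 (by positivity : 0 ≤ t * τ)
    refine le_trans ?_ h5
    have h6 : t * τ * (κ / 8 * τ⁻¹ ^ 2) = κ / 8 * (t / τ) := by field_simp
    rw [h6]
    exact mul_le_mul_of_nonneg_left (min_le_right _ _) (by positivity)

end LogSumExp

/-! ### Maurey's empirical method -/

section Sparsification

/-- Maurey's sparsification: a convex combination of bounded functions is approximated in weighted
`L²` by averages of `k` of them. -/
lemma exists_sum_sq_sub_le {J Z : Type*} [Fintype J] [Fintype Z] (φ : J → Z → ℝ)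
    (hφ : ∀ j z, |φ j z| ≤ 1) (w : Z → ℝ) (hw : ∀ z, 0 ≤ w z) (q : J → ℝ) (hq : ∀ j, 0 ≤ q j)
    (hq1 : ∑ j, q j = 1) (k : ℕ) :
    ∃ e : Fin k → J, ∑ z, w z * (k * ∑ j, q j * φ j z - ∑ i, φ (e i) z) ^ 2 ≤ k * ∑ z, w z := by
  induction k with
  | zero => exact ⟨Fin.elim0, by simp⟩
  | succ k ih =>
    obtain ⟨e, he⟩ := ih
    set v : Z → ℝ := fun z => ∑ j, q j * φ j z with hv
    set R : Z → ℝ := fun z => k * v z - ∑ i, φ (e i) z with hR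
    -- With `j` drawn from `q`, the squared residual grows by at most 1 on average, so some fixed
    -- `j` does as well for the weighted sum.
    have havg : ∀ z, ∑ j, q j * (R z + v z - φ j z) ^ 2 ≤ R z ^ 2 + 1 := by
      intro z
      have h1 : ∀ j, q j * (R z + v z - φ j z) ^ 2
          = (R z + v z) ^ 2 * q j - 2 * (R z + v z) * (q j * φ j z) + q j * φ j z ^ 2 := by
        intro j; ring
      simp only [h1, Finset.sum_add_distrib, Finset.sum_sub_distrib, ← Finset.mul_sum, hq1]
      have h2 : ∑ j, q j * φ j z ^ 2 ≤ 1 := by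
        rw [← hq1]
        exact Finset.sum_le_sum fun j _ => mul_le_of_le_one_right (hq j)
          ((sq_le_one_iff_abs_le_one _).2 (hφ j z))
      change (R z + v z) ^ 2 * 1 - 2 * (R z + v z) * v z + _ ≤ _
      nlinarith [sq_nonneg (v z)]
    obtain ⟨j, hj⟩ : ∃ j, ∑ z, w z * (R z + v z - φ j z) ^ 2 ≤ ∑ z, w z * (R z ^ 2 + 1) := by
      by_contra! hcon
      have h1 : ∑ j, q j * ∑ z, w z * (R z + v z - φ j z) ^ 2 ≤ ∑ z, w z * (R z ^ 2 + 1) := by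
        simp only [Finset.mul_sum]
        rw [Finset.sum_comm]
        refine Finset.sum_le_sum fun z _ => ?_
        have : ∀ j, q j * (w z * (R z + v z - φ j z) ^ 2)
            = w z * (q j * (R z + v z - φ j z) ^ 2) := fun j => by ring
        simp only [this, ← Finset.mul_sum]
        exact mul_le_mul_of_nonneg_left (havg z) (hw z)
      obtain ⟨j, -, hj⟩ : ∃ j ∈ Finset.univ, 0 < q j := by
        by_contra! h
        have := Finset.sum_nonpos h
        linarith
      have h2 : ∑ j, q j * ∑ z, w z * (R z ^ 2 + 1)
          < ∑ j, q j * ∑ z, w z * (R z + v z - φ j z) ^ 2 :=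
        Finset.sum_lt_sum (fun i _ => mul_le_mul_of_nonneg_left (hcon i).le (hq i))
          ⟨j, Finset.mem_univ _, mul_lt_mul_of_pos_left (hcon j) hj⟩
      rw [← Finset.sum_mul, hq1, one_mul] at h2
      linarith
    refine ⟨Fin.snoc e j, ?_⟩
    have h3 : ∀ z, ((k + 1 : ℕ) : ℝ) * v z - ∑ i, φ (Fin.snoc (α := fun _ => J) e j i) z
        = R z + v z - φ j z := by
      intro z
      rw [Fin.sum_univ_castSucc]
      simp only [Fin.snoc_castSucc, Fin.snoc_last, hR]
      push_cast; ring
    change ∑ z, w z * (((k + 1 : ℕ) : ℝ) * v z - _) ^ 2 ≤ _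
    simp only [h3]
    refine hj.trans ?_
    simp only [mul_add, mul_one, Finset.sum_add_distrib]
    push_cast
    linarith

end Sparsification

/-! ### Truncation of the population variance -/

section Truncation

lemma pow_four_le_exp {r : ℝ} (hr : 0 ≤ r) : r ^ 4 ≤ 24 * Real.exp r := by
  have := Real.pow_div_factorial_le_exp r hr 4
  rw [div_le_iff₀ (by positivity)] at this
  norm_num [Nat.factorial] at this
  linarith

/-- Under moment bounds, a lower bound for the weighted second moment about every centre passes to
truncated weights and truncated squares. -/
lemma exists_truncated_lower_bound (H M κ : ℝ) (hH : 0 < H) (hM : 0 < M) (hκ : 0 < κ) :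
    ∃ Q > 0, ∃ κ₀ > 0, ∀ (p : ℕ) (θ : PairSpace p) (r g : Config p → ℝ), (∀ x, 0 ≤ r x) →
      isingExp θ r = 1 → isingExp θ (fun x => Real.exp (r x)) ≤ H →
      isingExp θ (fun x => g x ^ 4) ≤ M →
      (∀ m, κ ≤ isingExp θ (fun x => r x * (g x - m) ^ 2)) →
      ∀ m, κ₀ ≤ isingExp θ (fun x => min (r x) Q * min ((g x - m) ^ 2) (Q ^ 2)) := by
  set S : ℝ := 24 * H + M + 2 with hS
  have hS0 : 0 < S := by positivity
  set b : ℝ := 2 * S with hb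
  have hb0 : 0 < b := by positivity
  set S₂ : ℝ := (3 + 8 * b ^ 2) * S with hS₂
  have hS₂0 : 0 < S₂ := by positivity
  set Q₀ : ℝ := 2 * S₂ / κ with hQ₀
  have hQ₀0 : 0 < Q₀ := by positivity
  refine ⟨Q₀ + 2 * b, by positivity, min (b ^ 2 / 2) (κ / 2), by positivity, ?_⟩
  intro p θ r g hr hr1 hrH hgM hvar m
  have hmom : isingExp θ (fun x => r x ^ 4 + g x ^ 4 + 2) ≤ S := by
    rw [isingExp_add, isingExp_add, isingExp_const]
    have h1 : isingExp θ (fun x => r x ^ 4) ≤ 24 * H := by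
      refine (isingExp_mono θ fun x => pow_four_le_exp (hr x)).trans ?_
      rw [isingExp_const_mul]; linarith
    linarith
  have hcross : ∀ x, r x * (|g x| + r x) ≤ r x ^ 4 + g x ^ 4 + 2 := by
    intro x
    have h1 : g x ^ 4 = |g x| ^ 4 := by rw [show 4 = 2 * 2 from rfl, pow_mul, pow_mul, sq_abs]
    rw [h1]
    have h2 : 0 ≤ |g x| := abs_nonneg _
    nlinarith [sq_nonneg (r x - |g x|), sq_nonneg (r x ^ 2 - 1), sq_nonneg (|g x| ^ 2 - 1)]
  -- Markov-type truncation: where `|g|` or `r` exceeds `B`, the factor `(|g| + r) / B` is at least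
  -- 1 and the left integrand is nonpositive.
  have htrunc : ∀ {B : ℝ} {G : Config p → ℝ}, 0 < B → (∀ x, 0 ≤ G x) →
      (∀ x, |g x| ≤ B → r x ≤ B → G x ≤ min (r x) (Q₀ + 2 * b)
        * min ((g x - m) ^ 2) ((Q₀ + 2 * b) ^ 2)) →
      isingExp θ G - isingExp θ (fun x => G x * (|g x| + r x)) / B ≤
        isingExp θ (fun x => min (r x) (Q₀ + 2 * b) * min ((g x - m) ^ 2) ((Q₀ + 2 * b) ^ 2)) := by
    intro B G hB hG h
    rw [div_eq_inv_mul, ← isingExp_const_mul, ← isingExp_sub]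
    refine isingExp_mono θ fun x => ?_
    have hpos : 0 ≤ B⁻¹ * (G x * (|g x| + r x)) := by
      have := hG x; have := hr x; positivity
    by_cases hx : |g x| ≤ B ∧ r x ≤ B
    · linarith [h x hx.1 hx.2]
    · have h1 : B ≤ |g x| + r x := by
        by_contra! hlt
        have := hr x
        have := abs_nonneg (g x)
        exact hx ⟨by linarith, by linarith⟩
      have h2 : G x ≤ B⁻¹ * (G x * (|g x| + r x)) := by
        rw [le_inv_mul_iff₀ hB, mul_comm]
        exact mul_le_mul_of_nonneg_left h1 (hG x)
      have h3 : 0 ≤ min (r x) (Q₀ + 2 * b) * min ((g x - m) ^ 2) ((Q₀ + 2 * b) ^ 2) :=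
        mul_nonneg (le_min (hr x) (by positivity)) (by positivity)
      linarith
  -- For a far centre, `(g - m)² ≥ b²` wherever `|g| ≤ b`, so the mass of `r` alone suffices; `b =
  -- 2S` limits the mass lost to one half. For a near centre the variance hypothesis is used, and
  -- `Q₀` limits its loss to `κ / 2`.
  rcases le_total (2 * b) |m| with hm | hm
  · refine (min_le_left _ _).trans (le_trans ?_
      (htrunc (B := b) (G := fun x => b ^ 2 * r x) hb0
        (fun x => mul_nonneg (sq_nonneg b) (hr x)) ?_))
    · have h1 : (fun x => b ^ 2 * r x * (|g x| + r x))
          = fun x => b ^ 2 * (r x * (|g x| + r x)) := by funext x; ring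
      rw [h1, isingExp_const_mul, isingExp_const_mul, hr1]
      have h2 := (isingExp_mono θ hcross).trans hmom
      have h3 : b ^ 2 * isingExp θ (fun x => r x * (|g x| + r x)) / b ≤ b ^ 2 / 2 := by
        rw [div_le_iff₀ hb0]
        have := mul_le_mul_of_nonneg_left h2 (sq_nonneg b)
        nlinarith
      linarith
    · intro x hg hrb
      rw [min_eq_left (by linarith), mul_comm]
      refine mul_le_mul_of_nonneg_left (le_min ?_ ?_) (hr x)
      · have h1 : |m| - |g x| ≤ |g x - m| := by
          rw [abs_sub_comm]; exact abs_sub_abs_le_abs_sub _ _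
        rw [← sq_abs (g x - m)]
        exact pow_le_pow_left₀ hb0.le (by linarith) 2
      · exact pow_le_pow_left₀ hb0.le (by linarith) 2
  · refine (min_le_right _ _).trans (le_trans ?_
      (htrunc (B := Q₀) (G := fun x => r x * (g x - m) ^ 2) hQ₀0
        (fun x => mul_nonneg (hr x) (sq_nonneg _)) ?_))
    · have h1 : ∀ x, r x * (g x - m) ^ 2 * (|g x| + r x)
          ≤ (3 + 8 * b ^ 2) * (r x ^ 4 + g x ^ 4 + 2) := by
        intro x
        have hm2 : m ^ 2 ≤ 4 * b ^ 2 := by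
          rw [← sq_abs]; nlinarith [abs_nonneg m]
        have h2 : (g x - m) ^ 2 ≤ 2 * |g x| ^ 2 + 8 * b ^ 2 := by
          rw [sq_abs]; nlinarith [sq_nonneg (g x + m)]
        have h3 : 0 ≤ r x * (|g x| + r x) :=
          mul_nonneg (hr x) (add_nonneg (abs_nonneg _) (hr x))
        have h4 := mul_le_mul_of_nonneg_left h2 h3
        have h5 := mul_le_mul_of_nonneg_left (hcross x) (by positivity : 0 ≤ 8 * b ^ 2)
        have h6 : g x ^ 4 = |g x| ^ 4 := by
          rw [show 4 = 2 * 2 from rfl, pow_mul, pow_mul, sq_abs]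
        have h7 : r x * (|g x| + r x) * (2 * |g x| ^ 2) ≤ 3 * (r x ^ 4 + g x ^ 4 + 2) := by
          rw [h6]
          nlinarith [sq_nonneg (r x ^ 2 - |g x| ^ 2), sq_nonneg (r x * |g x| - |g x| ^ 2),
            sq_nonneg (r x ^ 2), sq_nonneg (|g x| ^ 2)]
        nlinarith
      have h2 := (isingExp_mono θ h1).trans (le_of_eq (isingExp_const_mul θ _ _))
      have h3 := mul_le_mul_of_nonneg_left hmom (by positivity : 0 ≤ 3 + 8 * b ^ 2)
      have h4 : isingExp θ (fun x => r x * (g x - m) ^ 2 * (|g x| + r x)) / Q₀ ≤ κ / 2 := by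
        rw [div_le_iff₀ hQ₀0, hQ₀]
        have : κ / 2 * (2 * S₂ / κ) = S₂ := by field_simp
        rw [this]
        exact h2.trans h3
      linarith [hvar m]
    · intro x hg hrb
      rw [min_eq_left (by linarith), min_eq_left]
      rw [← sq_abs]
      refine pow_le_pow_left₀ (abs_nonneg _) ?_ 2
      exact (abs_sub _ _).trans (by linarith)

end Truncation

/-! ### Uniform deviation over the `ℓ₁` ball -/

section Uniform

variable {p : ℕ}

/-- The coordinates of the sufficient statistic, with both signs. -/
def signedStat (j : (Fin p × Fin p) × Bool) (x : Config p) : ℝ :=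
  (if j.2 then 1 else -1) * suffStat x j.1

lemma abs_signedStat_le (j : (Fin p × Fin p) × Bool) (x : Config p) : |signedStat j x| ≤ 1 := by
  rw [signedStat, abs_mul, abs_suffStat]
  split_ifs <;> simp

/-- The truncated quadratic `min (r, Q) min (v², Q²)`. -/
def truncSq (Q : ℝ) (r v : Config p → ℝ) (x : Config p) : ℝ :=
  min (r x) Q * min (v x ^ 2) (Q ^ 2)

/-- The average of the signed coordinates selected by `e`, scaled by `L`. -/
noncomputable def sparseStat (L : ℝ) {k : ℕ} (e : Fin k → (Fin p × Fin p) × Bool) (x : Config p) : ℝ :=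
  L / k * ∑ i, signedStat (e i) x

/-- Maurey's argument is run on the disjoint union of the sample and the configuration space, of
total weight 2, so a single `e` approximates in both norms. -/
lemma exists_sparseStat_approx (hp : 0 < p) (θ : PairSpace p) {n k : ℕ} (hn : 0 < n) (hk : 0 < k)
    (x : Fin n → Config p) {L : ℝ} (hL : 0 < L) (u : PairSpace p) (hu : l1Norm u ≤ L) :
    ∃ e : Fin k → (Fin p × Fin p) × Bool,
      1 / (n : ℝ) * ∑ i, (inner ℝ u (suffStat (x i)) - sparseStat L e (x i)) ^ 2
        + isingExp θ (fun y => (inner ℝ u (suffStat y) - sparseStat L e y) ^ 2)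
        ≤ 2 * L ^ 2 / k := by
  -- The unused mass `1 - ‖u‖₁ / L` is spread evenly over both signs of every coordinate, where it
  -- cancels.
  set c : ℝ := (1 - l1Norm u / L) / (2 * (p * p)) with hc
  have hc0 : 0 ≤ c := div_nonneg (sub_nonneg.2 ((div_le_one hL).2 hu)) (by positivity)
  set q : (Fin p × Fin p) × Bool → ℝ :=
    fun j => (|u j.1| + (if j.2 then 1 else -1) * u j.1) / (2 * L) + c with hq
  have hq0 : ∀ j, 0 ≤ q j := by
    intro j
    refine add_nonneg (div_nonneg ?_ (by positivity)) hc0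
    have := neg_abs_le (u j.1)
    have := le_abs_self (u j.1)
    split_ifs <;> linarith
  have hq1 : ∑ j, q j = 1 := by
    rw [Fintype.sum_prod_type]
    have h1 : ∀ e : Fin p × Fin p, ∑ b : Bool, q (e, b) = |u e| / L + 2 * c := by
      intro e
      simp only [Fintype.sum_bool, hq]
      norm_num
      field_simp
      ring
    simp only [h1, Finset.sum_add_distrib, ← Finset.sum_div]
    change l1Norm u / L + _ = 1
    simp only [Finset.sum_const, Finset.card_univ, Fintype.card_prod, Fintype.card_fin,
      nsmul_eq_mul, hc]
    push_cast
    have : (p : ℝ) ≠ 0 := by positivity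
    field_simp
    ring
  have hqv : ∀ y : Config p, ∑ j, q j * signedStat j y = inner ℝ u (suffStat y) / L := by
    intro y
    rw [Fintype.sum_prod_type, inner_suffStat, Finset.sum_div]
    refine Finset.sum_congr rfl fun e _ => ?_
    simp only [Fintype.sum_bool, hq, signedStat]
    norm_num
    field_simp
    ring
  obtain ⟨e, he⟩ := exists_sum_sq_sub_le (Z := Fin n ⊕ Config p)
    (fun j => Sum.elim (fun i => signedStat j (x i)) (signedStat j))
    (by rintro j (z | z) <;> exact abs_signedStat_le _ _)
    (Sum.elim (fun _ => 1 / (n : ℝ)) (isingProb θ))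
    (by rintro (z | z); exacts [by simp, (isingProb_pos θ z).le]) q hq0 hq1 k
  refine ⟨e, ?_⟩
  simp only [Fintype.sum_sum_type, Sum.elim_inl, Sum.elim_inr, hqv, sum_isingProb, Finset.sum_const,
    Finset.card_univ, Fintype.card_fin, nsmul_eq_mul] at he
  have hn' : (n : ℝ) ≠ 0 := by positivity
  have hk' : (k : ℝ) ≠ 0 := by positivity
  have hk0 : (0 : ℝ) < k := by positivity
  rw [mul_one_div_cancel hn'] at he
  have hscale : ∀ y : Config p, (inner ℝ u (suffStat y) - sparseStat L e y) ^ 2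
      = L ^ 2 / k ^ 2 * (k * (inner ℝ u (suffStat y) / L) - ∑ i, signedStat (e i) y) ^ 2 := by
    intro y
    rw [sparseStat]
    field_simp
  simp only [hscale, isingExp_const_mul, ← Finset.mul_sum]
  have h1 := mul_le_mul_of_nonneg_left he (by positivity : 0 ≤ L ^ 2 / k ^ 2)
  rw [← Finset.mul_sum] at h1
  have h2 : L ^ 2 / k ^ 2 * (k * (1 + 1)) = 2 * L ^ 2 / (k : ℝ) := by field_simp; norm_num
  rw [h2] at h1
  refine le_trans (le_of_eq ?_) h1
  rw [isingExp]
  ring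

lemma abs_min_sq_sub_min_sq_le {Q a b : ℝ} (hQ : 0 ≤ Q) :
    |min (a ^ 2) (Q ^ 2) - min (b ^ 2) (Q ^ 2)| ≤ 2 * Q * |a - b| := by
  have h : ∀ c : ℝ, min (c ^ 2) (Q ^ 2) = min |c| Q ^ 2 := by
    intro c
    rw [← sq_abs c]
    rcases le_total |c| Q with h | h
    · rw [min_eq_left h, min_eq_left (pow_le_pow_left₀ (abs_nonneg _) h 2)]
    · rw [min_eq_right h, min_eq_right (pow_le_pow_left₀ hQ h 2)]
  rw [h, h, sq_sub_sq, abs_mul]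
  refine mul_le_mul ?_ ?_ (abs_nonneg _) (by positivity)
  · have h1 : 0 ≤ min |a| Q := le_min (abs_nonneg _) hQ
    have h2 : 0 ≤ min |b| Q := le_min (abs_nonneg _) hQ
    rw [abs_of_nonneg (by linarith)]
    linarith [min_le_right |a| Q, min_le_right |b| Q]
  · calc |min |a| Q - min |b| Q| ≤ max |(|a| - |b|)| |Q - Q| := abs_min_sub_min_le_max _ _ _ _
      _ ≤ |a - b| := by
        simp [abs_abs_sub_abs_le]

/-- The truncated quadratic is `2Q²`-Lipschitz in `v`; the inequality of means turns this into a
squared error, the quantity that Maurey's argument controls. -/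
lemma abs_truncSq_sub_le {Q γ : ℝ} (hQ : 0 ≤ Q) (hγ : 0 < γ) {r : Config p → ℝ}
    (hr : ∀ x, 0 ≤ r x) (v w : Config p → ℝ) (x : Config p) :
    |truncSq Q r v x - truncSq Q r w x| ≤ Q ^ 4 / γ * (v x - w x) ^ 2 + γ := by
  rw [truncSq, truncSq, ← mul_sub, abs_mul]
  have h0 : 0 ≤ min (r x) Q := le_min (hr x) hQ
  have h1 : |min (r x) Q| ≤ Q := by rw [abs_of_nonneg h0]; exact min_le_right _ _
  refine (mul_le_mul h1 (abs_min_sq_sub_min_sq_le hQ) (abs_nonneg _) hQ).trans ?_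
  rw [← sq_abs (v x - w x)]
  set d := |v x - w x|
  have : Q ^ 4 / γ * d ^ 2 + γ - Q * (2 * Q * d) = (Q ^ 2 * d - γ) ^ 2 / γ := by
    field_simp; ring
  have h2 : 0 ≤ (Q ^ 2 * d - γ) ^ 2 / γ := by positivity
  linarith

/-- A lower deviation bound over the finite net of sparse functions extends to the `ℓ₁` ball. -/
lemma truncSq_lower_of_net (hp : 0 < p) (θ : PairSpace p) {n k : ℕ} (hn : 0 < n) (hk : 0 < k)
    (x : Fin n → Config p) {L Q γ : ℝ} (hL : 0 < L) (hQ : 0 ≤ Q) (hγ : 0 < γ)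
    (hkL : Q ^ 4 * (2 * L ^ 2 / k) ≤ γ ^ 2) {r : Config p → ℝ} (hr : ∀ x, 0 ≤ r x)
    (hnet : ∀ e : Fin k → (Fin p × Fin p) × Bool,
      isingExp θ (truncSq Q r (sparseStat L e)) - γ
        ≤ 1 / (n : ℝ) * ∑ i, truncSq Q r (sparseStat L e) (x i))
    (u : PairSpace p) (hu : l1Norm u ≤ L) :
    isingExp θ (truncSq Q r (fun y => inner ℝ u (suffStat y))) - 4 * γ
      ≤ 1 / (n : ℝ) * ∑ i, truncSq Q r (fun y => inner ℝ u (suffStat y)) (x i) := by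
  obtain ⟨e, he⟩ := exists_sparseStat_approx hp θ hn hk x hL u hu
  set v : Config p → ℝ := fun y => inner ℝ u (suffStat y) with hv
  set w := sparseStat L e
  have hd := fun y => abs_le.1 (abs_truncSq_sub_le hQ hγ hr v w y)
  have h1 : isingExp θ (truncSq Q r v) - isingExp θ (truncSq Q r w)
      ≤ Q ^ 4 / γ * isingExp θ (fun y => (v y - w y) ^ 2) + γ := by
    rw [← isingExp_sub, ← isingExp_const_mul]
    refine (isingExp_mono θ fun y => (hd y).2).trans ?_
    rw [isingExp_add, isingExp_const]
  have hn' : (n : ℝ) ≠ 0 := by positivity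
  have h2 : 1 / (n : ℝ) * ∑ i, truncSq Q r w (x i) - 1 / (n : ℝ) * ∑ i, truncSq Q r v (x i)
      ≤ Q ^ 4 / γ * (1 / (n : ℝ) * ∑ i, (v (x i) - w (x i)) ^ 2) + γ := by
    have h3 : ∑ i, (truncSq Q r w (x i) - truncSq Q r v (x i))
        ≤ ∑ i, (Q ^ 4 / γ * (v (x i) - w (x i)) ^ 2 + γ) :=
      Finset.sum_le_sum fun i _ => by linarith [(hd (x i)).1]
    rw [Finset.sum_sub_distrib, Finset.sum_add_distrib, ← Finset.mul_sum] at h3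
    simp only [Finset.sum_const, Finset.card_univ, Fintype.card_fin, nsmul_eq_mul] at h3
    have h4 := mul_le_mul_of_nonneg_left h3 (by positivity : 0 ≤ 1 / (n : ℝ))
    have h5 : 1 / (n : ℝ) * (n * γ) = γ := by field_simp
    linarith
  have h6 := mul_le_mul_of_nonneg_left he (by positivity : 0 ≤ Q ^ 4 / γ)
  -- Of the total `4γ`, one comes from the net, one from this combined `L²` error, and two from the
  -- additive terms of the two comparisons.
  have h7 : Q ^ 4 / γ * (2 * L ^ 2 / k) ≤ γ := by
    rw [div_mul_eq_mul_div, div_le_iff₀ hγ]; linarith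
  linarith [hnet e]

lemma truncSq_nonneg {Q : ℝ} (hQ : 0 ≤ Q) {r : Config p → ℝ} (hr : ∀ x, 0 ≤ r x)
    (v : Config p → ℝ) (x : Config p) : 0 ≤ truncSq Q r v x :=
  mul_nonneg (le_min (hr x) hQ) (by positivity)

lemma truncSq_le {Q : ℝ} (hQ : 0 ≤ Q) {r : Config p → ℝ}
    (v : Config p → ℝ) (x : Config p) : truncSq Q r v x ≤ Q ^ 3 := by
  refine (mul_le_mul (min_le_right _ _) (min_le_right _ _) (by positivity) hQ).trans (le_of_eq ?_)
  ring

/-- Union bound over the `(2p²)^k` choices of `e`; truncation bounds every summand by `Q³`, so the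
rate does not depend on `L` or `k`. -/
lemma measureReal_net_le {Ω : Type*} [MeasurableSpace Ω] {μ : Measure Ω}
    [IsProbabilityMeasure μ] {θ : PairSpace p} {n : ℕ} (hn : 0 < n) {X : Fin n → Ω → Config p}
    (hX : ∀ i, Measurable (X i)) (hl : ∀ i x, μ.real (X i ⁻¹' {x}) = isingProb θ x)
    (hi : iIndepFun X μ) (k : ℕ) {L Q γ : ℝ} (hQ : 0 ≤ Q) (hγ : 0 < γ) (hγ1 : γ ≤ 1)
    {r : Config p → ℝ} (hr : ∀ x, 0 ≤ r x) :
    μ.real {ω | ¬ ∀ e : Fin k → (Fin p × Fin p) × Bool,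
      isingExp θ (truncSq Q r (sparseStat L e)) - γ
        ≤ 1 / (n : ℝ) * ∑ i, truncSq Q r (sparseStat L e) (X i ω)}
      ≤ (2 * (p : ℝ) ^ 2) ^ k * Real.exp (-(n * γ ^ 2 / (8 * Real.exp (2 * Q ^ 3)))) := by
  set Y : (Fin k → (Fin p × Fin p) × Bool) → Config p → ℝ := fun e x =>
    isingExp θ (truncSq Q r (sparseStat L e)) - truncSq Q r (sparseStat L e) x with hY
  have hn0 : (0 : ℝ) < n := by positivity
  have hsub : {ω | ¬ ∀ e : Fin k → (Fin p × Fin p) × Bool,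
      isingExp θ (truncSq Q r (sparseStat L e)) - γ
        ≤ 1 / (n : ℝ) * ∑ i, truncSq Q r (sparseStat L e) (X i ω)}
      ⊆ ⋃ e ∈ Finset.univ, {ω | 0 ≤ ∑ i, (Y e (X i ω) - γ)} := by
    intro ω hω
    simp only [Set.mem_ofPred_eq, not_forall, not_le] at hω
    obtain ⟨e, he⟩ := hω
    simp only [Finset.mem_univ, Set.iUnion_true, Set.mem_iUnion, Set.mem_ofPred_eq]
    refine ⟨e, ?_⟩
    simp only [hY, Finset.sum_sub_distrib, Finset.sum_const, Finset.card_univ, Fintype.card_fin,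
      nsmul_eq_mul]
    rw [one_div_mul_eq_div, div_lt_iff₀ hn0] at he
    linarith
  refine (measureReal_mono hsub (measure_ne_top _ _)).trans ((measureReal_biUnion_finset_le _ _).trans ?_)
  have hone : ∀ e, μ.real {ω | 0 ≤ ∑ i, (Y e (X i ω) - γ)}
      ≤ Real.exp (-(n * γ ^ 2 / (8 * Real.exp (2 * Q ^ 3)))) := by
    intro e
    have h0 : isingExp θ (Y e) = 0 := by
      simp only [hY, isingExp_sub, isingExp_const]
      exact sub_self _
    have hbd : ∀ x, |Y e x| ≤ Q ^ 3 := by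
      intro x
      have h1 := truncSq_nonneg hQ hr (sparseStat L e)
      have h2 := fun x => truncSq_le (r := r) hQ (sparseStat L e) x
      have h3 := isingExp_nonneg θ h1
      have h4 := (isingExp_mono θ h2).trans (le_of_eq (isingExp_const θ _))
      exact abs_sub_le_of_nonneg_of_le h3 h4 (h1 x) (h2 x)
    have hA : 2 * isingExp θ (fun x => Real.exp (2 * |Y e x|)) ≤ 2 * Real.exp (2 * Q ^ 3) := by
      refine mul_le_mul_of_nonneg_left ?_ zero_le_two
      refine (isingExp_mono θ (g := fun _ => Real.exp (2 * Q ^ 3)) fun x =>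
        Real.exp_le_exp.2 (by linarith [hbd x])).trans (le_of_eq (isingExp_const θ _))
    have h1 : 1 ≤ Real.exp (2 * Q ^ 3) := Real.one_le_exp (by positivity)
    refine (measureReal_sum_sub_nonneg_le hX hl hi h0 hA (by positivity) hγ.le
      (by linarith)).trans (le_of_eq ?_)
    congr 3; ring
  refine (Finset.sum_le_sum fun e _ => hone e).trans (le_of_eq ?_)
  simp only [Finset.sum_const, nsmul_eq_mul, Finset.card_univ, Fintype.card_pi, Fintype.card_prod,
    Fintype.card_fin, Fintype.card_bool, Finset.prod_const]
  push_cast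
  ring

end Uniform

/-! ### Concentration of the gradient at the true change -/

section Gradient

variable {p : ℕ}

/-- Uniform control of the self-normalized weighted averages of the sufficient statistic. -/
lemma measureReal_weighted_suffStat_le {Ω : Type*} [MeasurableSpace Ω] {μ : Measure Ω}
    [IsProbabilityMeasure μ] {θ : PairSpace p} {n : ℕ} {X : Fin n → Ω → Config p}
    (hX : ∀ i, Measurable (X i)) (hl : ∀ i x, μ.real (X i ⁻¹' {x}) = isingProb θ x)
    (hi : iIndepFun X μ) {r : Config p → ℝ} (hr : ∀ x, 0 ≤ r x) (hr1 : isingExp θ r = 1)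
    {A t : ℝ} (hA : 2 * (Real.exp 4 * isingExp θ (fun x => Real.exp (8 * r x))) ≤ A)
    (ht : 0 ≤ t) :
    μ.real {ω | ¬ ∀ e, |∑ i, r (X i ω) * (suffStat (X i ω) e
        - isingExp θ (fun x => r x * suffStat x e))| ≤ t * ∑ i, r (X i ω)}
      ≤ 2 * (p : ℝ) ^ 2 * Real.exp (-(n * t ^ 2 / (4 * A))) := by
  set m : Fin p × Fin p → ℝ := fun e => isingExp θ (fun x => r x * suffStat x e) with hm
  have hm1 : ∀ e, |m e| ≤ 1 := by
    intro e
    have h1 : ∀ x, |r x * suffStat x e| ≤ r x := fun x => by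
      rw [abs_mul, abs_suffStat, mul_one, abs_of_nonneg (hr x)]
    rw [abs_le]
    constructor
    · have := isingExp_mono θ fun x => (abs_le.1 (h1 x)).1
      have h2 := isingExp_const_mul θ (-1) r
      simp only [neg_one_mul, hr1] at h2
      linarith
    · exact (isingExp_mono θ fun x => (abs_le.1 (h1 x)).2).trans hr1.le
  have hdev : ∀ e x, |suffStat x e - m e| ≤ 2 := by
    intro e x
    refine (abs_sub _ _).trans ?_
    rw [abs_suffStat]
    linarith [hm1 e]
  -- For `t ≥ 2` the bound is deterministic; otherwise `t` lies in the range of the Bernstein-type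
  -- bound.
  rcases le_total 2 t with ht2 | ht2
  · have hempty : {ω | ¬ ∀ e, |∑ i, r (X i ω) * (suffStat (X i ω) e - m e)|
        ≤ t * ∑ i, r (X i ω)} = ∅ := by
      ext ω
      simp only [Set.mem_ofPred_eq, Set.mem_empty_iff_false, iff_false, not_not]
      intro e
      refine (Finset.abs_sum_le_sum_abs _ _).trans ?_
      rw [Finset.mul_sum]
      refine Finset.sum_le_sum fun i _ => ?_
      rw [abs_mul, abs_of_nonneg (hr _), mul_comm]
      exact mul_le_mul_of_nonneg_right ((hdev e _).trans ht2) (hr _)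
    rw [hempty, measureReal_empty]
    positivity
  set σ : Bool → ℝ := fun b => if b then 1 else -1 with hσ
  have hσ1 : ∀ b, |σ b| = 1 := by intro b; cases b <;> simp [hσ]
  -- Moving `t ∑ r` to the left turns the self-normalized event into one about an i.i.d. sum with
  -- mean `-t` per term; adding `t` centres it.
  set Y : (Fin p × Fin p) × Bool → Config p → ℝ :=
    fun j x => r x * (σ j.2 * (suffStat x j.1 - m j.1) - t) + t with hY
  have hsub : {ω | ¬ ∀ e, |∑ i, r (X i ω) * (suffStat (X i ω) e - m e)| ≤ t * ∑ i, r (X i ω)}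
      ⊆ ⋃ j ∈ Finset.univ, {ω | 0 ≤ ∑ i, (Y j (X i ω) - t)} := by
    intro ω hω
    simp only [Set.mem_ofPred_eq, not_forall, not_le] at hω
    obtain ⟨e, he⟩ := hω
    simp only [Finset.mem_univ, Set.iUnion_true, Set.mem_iUnion, Set.mem_ofPred_eq]
    have hsum : ∀ b, ∑ i, (Y (e, b) (X i ω) - t)
        = σ b * ∑ i, r (X i ω) * (suffStat (X i ω) e - m e) - t * ∑ i, r (X i ω) := by
      intro b
      rw [Finset.mul_sum, Finset.mul_sum, ← Finset.sum_sub_distrib]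
      refine Finset.sum_congr rfl fun i _ => ?_
      simp only [hY]; ring
    rcases lt_abs.1 he with h | h
    · refine ⟨(e, true), ?_⟩
      rw [hsum]
      simp only [hσ, if_true]; linarith
    · refine ⟨(e, false), ?_⟩
      rw [hsum]
      simp only [hσ, Bool.false_eq_true, if_false]; linarith
  have h8 : 1 ≤ isingExp θ (fun x => Real.exp (8 * r x)) := by
    rw [← isingExp_const θ 1]
    exact isingExp_mono θ fun x => Real.one_le_exp (by have := hr x; positivity)
  have hA2 : 2 ≤ A := by
    have : (1 : ℝ) ≤ Real.exp 4 := Real.one_le_exp (by norm_num)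
    nlinarith
  refine (measureReal_mono hsub (measure_ne_top _ _)).trans
    ((measureReal_biUnion_finset_le _ _).trans ?_)
  have hone : ∀ j, μ.real {ω | 0 ≤ ∑ i, (Y j (X i ω) - t)}
      ≤ Real.exp (-(n * t ^ 2 / (4 * A))) := by
    intro j
    have h0 : isingExp θ (Y j) = 0 := by
      have h1 : Y j = fun x => σ j.2 * (r x * suffStat x j.1)
          + (-(σ j.2 * m j.1 + t) * r x + t) := by
        funext x; simp only [hY]; ring
      rw [h1, isingExp_add, isingExp_add, isingExp_const_mul, isingExp_const_mul, isingExp_const,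
        hr1]
      simp only [hm]; ring
    have hbd : ∀ x, |Y j x| ≤ 4 * r x + 2 := by
      intro x
      have h1 : |σ j.2 * (suffStat x j.1 - m j.1) - t| ≤ 4 := by
        refine (abs_sub _ _).trans ?_
        rw [abs_mul, hσ1, one_mul, abs_of_nonneg ht]
        linarith [hdev j.1 x]
      refine (abs_add_le _ _).trans ?_
      rw [abs_mul, abs_of_nonneg (hr x), abs_of_nonneg ht]
      nlinarith [hr x]
    refine measureReal_sum_sub_nonneg_le hX hl hi h0 (le_trans ?_ hA) (by linarith) ht
      (by linarith)
    refine mul_le_mul_of_nonneg_left ?_ zero_le_two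
    rw [← isingExp_const_mul]
    refine isingExp_mono θ fun x => ?_
    rw [← Real.exp_add]
    exact Real.exp_le_exp.2 (by linarith [hbd x])
  refine (Finset.sum_le_sum fun e _ => hone e).trans (le_of_eq ?_)
  simp only [Finset.sum_const, nsmul_eq_mul, Finset.card_univ, Fintype.card_prod,
    Fintype.card_fin, Fintype.card_bool]
  push_cast
  ring

lemma measureReal_sum_weight_gt_le {Ω : Type*} [MeasurableSpace Ω] {μ : Measure Ω}
    [IsProbabilityMeasure μ] {θ : PairSpace p} {n : ℕ} {X : Fin n → Ω → Config p}
    (hX : ∀ i, Measurable (X i)) (hl : ∀ i x, μ.real (X i ⁻¹' {x}) = isingProb θ x)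
    (hi : iIndepFun X μ) {r : Config p → ℝ} (hr : ∀ x, 0 ≤ r x) (hr1 : isingExp θ r = 1)
    {A : ℝ} (hA : 2 * (Real.exp 4 * isingExp θ (fun x => Real.exp (8 * r x))) ≤ A)
    (hA1 : 1 ≤ A) :
    μ.real {ω | ¬ ∑ i, r (X i ω) ≤ 2 * n} ≤ Real.exp (-(n / (4 * A))) := by
  have h0 : isingExp θ (fun x => r x - 1) = 0 := by
    rw [isingExp_sub, isingExp_const]
    exact sub_eq_zero.2 hr1
  have h := measureReal_sum_sub_nonneg_le hX hl hi h0 (A := A) (t := 1) (le_trans ?_ hA)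
    (by linarith) zero_le_one (by linarith)
  · rw [one_pow, mul_one] at h
    refine (measureReal_mono ?_ (measure_ne_top _ _)).trans h
    intro ω hω
    simp only [Set.mem_ofPred_eq, not_le, Finset.sum_sub_distrib, Finset.sum_const,
      Finset.card_univ, Fintype.card_fin, nsmul_eq_mul] at hω ⊢
    linarith
  · refine mul_le_mul_of_nonneg_left ?_ zero_le_two
    rw [← isingExp_const_mul]
    refine isingExp_mono θ fun x => ?_
    rw [← Real.exp_add]
    refine Real.exp_le_exp.2 ?_
    have := abs_sub (r x) 1
    rw [abs_of_nonneg (hr x), abs_one] at this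
    linarith [hr x]

end Gradient

/-! ### Deterministic analysis of the penalized minimizer -/

section Deterministic

variable {p : ℕ}

/-- The weights `r(xᵢ) / ∑ⱼ r(xⱼ)` which the empirical loss puts on the second sample. -/
noncomputable def ratioWeight {n : ℕ} (r : Config p → ℝ) (x : Fin n → Config p) (i : Fin n) : ℝ :=
  r (x i) / ∑ j, r (x j)

lemma ratioWeight_nonneg {n : ℕ} {r : Config p → ℝ} (hr : ∀ x, 0 < r x) (x : Fin n → Config p)
    (i : Fin n) : 0 ≤ ratioWeight r x i :=
  div_nonneg (hr _).le (Finset.sum_nonneg fun _ _ => (hr _).le)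

lemma sum_ratio_pos {n : ℕ} (hn : 0 < n) {r : Config p → ℝ} (hr : ∀ x, 0 < r x)
    (x : Fin n → Config p) : 0 < ∑ j, r (x j) :=
  Finset.sum_pos (fun _ _ => hr _) ⟨⟨0, hn⟩, Finset.mem_univ _⟩

lemma sum_ratioWeight {n : ℕ} (hn : 0 < n) {r : Config p → ℝ} (hr : ∀ x, 0 < r x)
    (x : Fin n → Config p) : ∑ i, ratioWeight r x i = 1 := by
  simp only [ratioWeight, ← Finset.sum_div]
  exact div_self (sum_ratio_pos hn hr x).ne'

/-- Since `exp ⟨T, δ⟩ = Z r`, the normalizer `Z` cancels in the weights, so any `θ` may be used. -/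
lemma empLoss_add_sub {n₁ n₂ : ℕ} (hn₂ : 0 < n₂) (x₁ : Fin n₁ → Config p)
    (x₂ : Fin n₂ → Config p) (θ δ D : PairSpace p) :
    empLoss x₁ x₂ (δ + D) - empLoss x₁ x₂ δ
      = -(1 / (n₁ : ℝ)) * ∑ i, inner ℝ D (suffStat (x₁ i))
        + Real.log (∑ i, ratioWeight (densityRatio θ δ) x₂ i
          * Real.exp (inner ℝ D (suffStat (x₂ i)))) := by
  set Z := isingExp θ (fun y => Real.exp (inner ℝ (suffStat y) δ)) with hZ
  have hZ0 : 0 < Z := isingExp_exp_pos _ _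
  have hS := sum_ratio_pos hn₂ (densityRatio_pos θ δ) x₂
  set S := ∑ j, densityRatio θ δ (x₂ j) with hSdef
  have hr : ∀ x : Config p, Real.exp (inner ℝ (suffStat x) δ) = Z * densityRatio θ δ x := by
    intro x
    rw [densityRatio, ← hZ]; field_simp
  have hn : (0 : ℝ) < n₂ := by exact_mod_cast hn₂
  have h1 : 1 / (n₂ : ℝ) * ∑ i, Real.exp (inner ℝ (suffStat (x₂ i)) δ) = Z * S / n₂ := by
    simp only [hr, ← Finset.mul_sum, ← hSdef]; ring
  have h2 : 1 / (n₂ : ℝ) * ∑ i, Real.exp (inner ℝ (suffStat (x₂ i)) (δ + D))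
      = Z * S / n₂ * ∑ i, ratioWeight (densityRatio θ δ) x₂ i
          * Real.exp (inner ℝ D (suffStat (x₂ i))) := by
    rw [Finset.mul_sum, Finset.mul_sum]
    refine Finset.sum_congr rfl fun i _ => ?_
    rw [inner_add_right, Real.exp_add, hr, ratioWeight, ← hSdef, real_inner_comm D]
    field_simp
  have h3 : 0 < ∑ i, ratioWeight (densityRatio θ δ) x₂ i
      * Real.exp (inner ℝ D (suffStat (x₂ i))) :=
    Finset.sum_pos (fun i _ => mul_pos (div_pos (densityRatio_pos _ _ _) hS) (Real.exp_pos _))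
      ⟨⟨0, hn₂⟩, Finset.mem_univ _⟩
  rw [empLoss, empLoss, h1, h2, Real.log_mul (by positivity) h3.ne']
  simp only [inner_add_right, Finset.sum_add_distrib, real_inner_comm D]
  ring

/-- The basic inequality for the penalized minimizer `δ + D`. -/
lemma basic_inequality {n₁ n₂ : ℕ} (hn₂ : 0 < n₂) {x₁ : Fin n₁ → Config p}
    {x₂ : Fin n₂ → Config p} {θ δ D : PairSpace p} {lam b : ℝ} (hδ : δ ∈ isingParams p)
    (hest : IsEstimator lam x₁ x₂ (δ + D))
    (hgrad : ∀ e, |-(1 / (n₁ : ℝ)) * ∑ i, suffStat (x₁ i) e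
      + ∑ i, ratioWeight (densityRatio θ δ) x₂ i * suffStat (x₂ i) e| ≤ b) :
    Real.log (∑ i, ratioWeight (densityRatio θ δ) x₂ i
          * Real.exp (inner ℝ D (suffStat (x₂ i))))
        - ∑ i, ratioWeight (densityRatio θ δ) x₂ i * inner ℝ D (suffStat (x₂ i))
        + lam * l1Norm (δ + D)
      ≤ lam * l1Norm δ + b * l1Norm D := by
  have h1 := empLoss_add_sub hn₂ x₁ x₂ θ δ D
  have h2 : empLoss x₁ x₂ (δ + D) + lam * l1Norm (δ + D) ≤ empLoss x₁ x₂ δ + lam * l1Norm δ :=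
    hest.2 hδ
  set w := ratioWeight (densityRatio θ δ) x₂
  have h3 : -(b * l1Norm D) ≤ -(1 / (n₁ : ℝ)) * ∑ i, inner ℝ D (suffStat (x₁ i))
      + ∑ i, w i * inner ℝ D (suffStat (x₂ i)) := by
    have h4 : -(1 / (n₁ : ℝ)) * ∑ i, inner ℝ D (suffStat (x₁ i))
        + ∑ i, w i * inner ℝ D (suffStat (x₂ i))
        = ∑ e, D e * (-(1 / (n₁ : ℝ)) * ∑ i, suffStat (x₁ i) e
          + ∑ i, w i * suffStat (x₂ i) e) := by
      simp only [inner_suffStat, mul_add, Finset.sum_add_distrib, Finset.mul_sum]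
      congr 1
      · rw [Finset.sum_comm]
        exact Finset.sum_congr rfl fun e _ => Finset.sum_congr rfl fun i _ => by ring
      · rw [Finset.sum_comm]
        exact Finset.sum_congr rfl fun e _ => Finset.sum_congr rfl fun i _ => by ring
    rw [h4, l1Norm, Finset.mul_sum, ← Finset.sum_neg_distrib]
    refine Finset.sum_le_sum fun e _ => (neg_le_neg ?_).trans (neg_abs_le _)
    rw [abs_mul, mul_comm]
    exact mul_le_mul_of_nonneg_right (hgrad e) (abs_nonneg _)
  linarith

/-- In the quadratic branch one factor `‖D‖` cancels. In the linear branch `‖D‖₁` is bounded by a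
multiple of `‖δ‖₁ ≤ Ψ B`, so the a priori bound on `δ` replaces any smallness of `lam`. -/
lemma norm_le_of_growth {β κ τ B lam : ℝ} (hβ : 1 < β) (hκ : 0 < κ) (hτ : 0 < τ)
    (hlam : 0 ≤ lam) {δ D : PairSpace p} (hB : ‖δ‖ ≤ B) (hD : D ∈ errorSet β δ)
    (hD0 : 0 < ‖D‖)
    (hg : κ / 8 * min (‖D‖ ^ 2) (‖D‖ / τ) + lam * l1Norm (δ + D)
      ≤ lam * l1Norm δ + lam / β * l1Norm D) :
    ‖D‖ ≤ (16 / κ + 8 * τ * (1 + 2 * β / (β - 1)) * B / κ)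
      * (normCompat (errorCone β δ) * lam) := by
  set ψ := normCompat (errorCone β δ) with hψ
  have hψ0 : 0 ≤ ψ := normCompat_nonneg _
  have hB0 : 0 ≤ B := (norm_nonneg _).trans hB
  have hb0 : 0 ≤ 2 * β / (β - 1) := div_nonneg (by linarith) (by linarith)
  have hD1 : l1Norm D ≤ ψ * ‖D‖ := l1Norm_le_normCompat_mul hβ (mem_errorCone_of_mem_errorSet hD)
  have hδ1 : l1Norm δ ≤ ψ * B := by
    have := l1Norm_le_normCompat_mul hβ
      (mem_errorCone_of_mem_errorSet (neg_mem_errorSet (by linarith : 0 ≤ β) δ))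
    rw [l1Norm_neg, norm_neg] at this
    exact this.trans (mul_le_mul_of_nonneg_left hB hψ0)
  have hDδ := errorSet_l1Norm_le_mul hβ hD
  have hlb : lam / β * l1Norm D ≤ lam * l1Norm D :=
    mul_le_mul_of_nonneg_right (div_le_self hlam hβ.le) (l1Norm_nonneg D)
  have hx0 : 0 ≤ ψ * lam := mul_nonneg hψ0 hlam
  have hc1 : 0 ≤ 16 / κ * (ψ * lam) := by positivity
  have hc2 : 0 ≤ 8 * τ * (1 + 2 * β / (β - 1)) * B / κ * (ψ * lam) := by positivity
  rw [add_mul]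
  rcases le_total (‖D‖ ^ 2) (‖D‖ / τ) with h | h
  · rw [min_eq_left h] at hg
    have h1 : l1Norm δ ≤ l1Norm (δ + D) + l1Norm D := by
      have := l1Norm_add_le (δ + D) (-D)
      rwa [l1Norm_neg, add_neg_cancel_right] at this
    have h2 : κ / 8 * ‖D‖ ^ 2 ≤ 2 * lam * (ψ * ‖D‖) := by
      have h3 := mul_le_mul_of_nonneg_left h1 hlam
      have h4 := mul_le_mul_of_nonneg_left hD1 hlam
      linarith
    have h5 : κ / 8 * ‖D‖ ≤ 2 * (ψ * lam) := by
      refine le_of_mul_le_mul_right ?_ hD0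
      linarith
    have h6 : ‖D‖ ≤ 16 / κ * (ψ * lam) := by
      rw [div_mul_eq_mul_div, le_div_iff₀ hκ]; linarith
    linarith
  · rw [min_eq_right h] at hg
    have h1 : κ / 8 * (‖D‖ / τ) ≤ (1 + 2 * β / (β - 1)) * (lam * (ψ * B)) := by
      have h3 := mul_nonneg hlam (l1Norm_nonneg (δ + D))
      have h4 := mul_le_mul_of_nonneg_left hDδ hlam
      have h5 := mul_le_mul_of_nonneg_left hδ1 hlam
      have h6 := mul_le_mul_of_nonneg_left h5 hb0
      linarith
    have h6 : ‖D‖ ≤ 8 * τ * (1 + 2 * β / (β - 1)) * B / κ * (ψ * lam) := by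
      rw [div_mul_eq_mul_div, le_div_iff₀ hκ]
      have h7 := mul_le_mul_of_nonneg_left h1 (by positivity : 0 ≤ 8 * τ)
      have h8 : 8 * τ * (κ / 8 * (‖D‖ / τ)) = ‖D‖ * κ := by field_simp
      rw [h8] at h7
      linarith
    linarith

/-- Diagonal coordinates of `T` equal 1, so constants are linear in `T`. This absorbs the random
centre; `u'` may leave the Ising parameters, but the net covers the full `ℓ₁` ball. -/
lemma exists_inner_sub_const (hp : 0 < p) (u : PairSpace p) (m : ℝ) :
    ∃ u' : PairSpace p, l1Norm u' ≤ l1Norm u + |m| ∧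
      ∀ x : Config p, inner ℝ u' (suffStat x) = inner ℝ u (suffStat x) - m := by
  set e : Fin p × Fin p := (⟨0, hp⟩, ⟨0, hp⟩)
  refine ⟨u + EuclideanSpace.single e (-m), (l1Norm_add_le _ _).trans ?_, fun x => ?_⟩
  · refine add_le_add_right (le_of_eq ?_) _
    rw [l1Norm, Finset.sum_eq_single e]
    · simp
    · intro e' _ h; simp [h]
    · simp
  · rw [inner_add_left, EuclideanSpace.inner_single_left, suffStat_diag]
    simp; ring

/-- Growth of the empirical log-partition function along a direction, from a lower bound on the
truncated quadratic and an upper bound on the total weight. -/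
lemma ratioWeight_growth {n : ℕ} (hn : 0 < n) {x : Fin n → Config p} {r : Config p → ℝ}
    (hr : ∀ x, 0 < r x) (hsum : ∑ i, r (x i) ≤ 2 * n) {κ Q : ℝ} (hκ : 0 ≤ κ) (hQ : 0 < Q)
    {D : PairSpace p} (hD : 0 < ‖D‖)
    (hrsc : ∀ m : ℝ, |m| ≤ l1Norm (‖D‖⁻¹ • D) →
      κ ≤ 1 / (n : ℝ) * ∑ i, min (r (x i)) Q
        * min ((inner ℝ (‖D‖⁻¹ • D) (suffStat (x i)) - m) ^ 2) (Q ^ 2)) :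
    κ / 2 / 8 * min (‖D‖ ^ 2) (‖D‖ / Q) ≤
      Real.log (∑ i, ratioWeight r x i * Real.exp (inner ℝ D (suffStat (x i))))
        - ∑ i, ratioWeight r x i * inner ℝ D (suffStat (x i)) := by
  set u := ‖D‖⁻¹ • D with hu
  have hDu : ∀ i, inner ℝ D (suffStat (x i)) = ‖D‖ * inner ℝ u (suffStat (x i)) := by
    intro i
    rw [hu, real_inner_smul_left]; field_simp
  set w := ratioWeight r x with hw
  have hw0 : ∀ i, 0 ≤ w i := ratioWeight_nonneg hr x
  have hw1 : ∑ i, w i = 1 := sum_ratioWeight hn hr x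
  have hS := sum_ratio_pos hn hr x
  have hn0 : (0 : ℝ) < n := by exact_mod_cast hn
  set v : Fin n → ℝ := fun i => inner ℝ u (suffStat (x i)) with hv
  have hm : |∑ i, w i * v i| ≤ l1Norm u := by
    refine (Finset.abs_sum_le_sum_abs _ _).trans ?_
    rw [← one_mul (l1Norm u), ← hw1, Finset.sum_mul]
    refine Finset.sum_le_sum fun i _ => ?_
    rw [abs_mul, abs_of_nonneg (hw0 i)]
    exact mul_le_mul_of_nonneg_left (abs_inner_suffStat_le _ _) (hw0 i)
  have h1 := hrsc _ hm
  set m := ∑ i, w i * v i with hmdef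
  have h2 : κ / 2 ≤ ∑ i, w i * min ((v i - m) ^ 2) (Q ^ 2) := by
    have h3 : ∑ i, min (r (x i)) Q * min ((v i - m) ^ 2) (Q ^ 2)
        ≤ (∑ j, r (x j)) * ∑ i, w i * min ((v i - m) ^ 2) (Q ^ 2) := by
      rw [Finset.mul_sum]
      refine Finset.sum_le_sum fun i _ => ?_
      rw [← mul_assoc, hw, ratioWeight, mul_div_cancel₀ _ hS.ne']
      exact mul_le_mul_of_nonneg_right (min_le_left _ _) (by positivity)
    have h4 : 0 ≤ ∑ i, w i * min ((v i - m) ^ 2) (Q ^ 2) :=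
      Finset.sum_nonneg fun i _ => mul_nonneg (hw0 i) (by positivity)
    rw [one_div_mul_eq_div, le_div_iff₀ hn0] at h1
    have h5 := mul_le_mul_of_nonneg_right hsum h4
    refine le_of_mul_le_mul_right ?_ hn0
    linarith
  have h6 := log_sum_mul_exp_growth w v hw0 hw1 (by positivity : 0 ≤ κ / 2) hQ hD h2
  simp only [hDu]
  rw [Finset.mul_sum] at h6
  have h7 : ∀ i, w i * (‖D‖ * inner ℝ u (suffStat (x i))) = ‖D‖ * (w i * v i) := fun i => by
    simp only [hv]; ring
  simp only [h7]
  exact h6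

end Deterministic

/-! ### From the good events to the error bound -/

section Assembly

variable {p : ℕ}

/-- The deterministic error bound, on the event where the gradient at the true change is dominated
by the penalty and the truncated quadratic is bounded below on the error cone. -/
lemma norm_sub_le_of_isEstimator {β κ Q B lam : ℝ} {s n₁ n₂ : ℕ} (hβ : 1 < β) (hκ : 0 < κ)
    (hQ : 0 < Q) (hlam : 0 < lam) (hn₂ : 0 < n₂) {x₁ : Fin n₁ → Config p}
    {x₂ : Fin n₂ → Config p} {θ δ δhat : PairSpace p} (hδ : δ ∈ isingParams p)
    (hs : l0Norm δ ≤ s) (hB : ‖δ‖ ≤ B) (hest : IsEstimator lam x₁ x₂ δhat)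
    (hgrad : ∀ e, |-(1 / (n₁ : ℝ)) * ∑ i, suffStat (x₁ i) e
      + ∑ i, ratioWeight (densityRatio θ δ) x₂ i * suffStat (x₂ i) e| ≤ lam / β)
    (hrsc : s ≠ 0 → ∑ i, densityRatio θ δ (x₂ i) ≤ 2 * n₂ ∧
      ∀ u ∈ errorCone β δ, u ∈ isingParams p → ‖u‖ = 1 → ∀ m : ℝ, |m| ≤ l1Norm u →
        κ ≤ 1 / (n₂ : ℝ) * ∑ i, min (densityRatio θ δ (x₂ i)) Q
          * min ((inner ℝ u (suffStat (x₂ i)) - m) ^ 2) (Q ^ 2)) :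
    ‖δ - δhat‖ ≤ (16 / (κ / 2) + 8 * Q * (1 + 2 * β / (β - 1)) * B / (κ / 2))
      * (normCompat (errorCone β δ) * lam) := by
  obtain ⟨D, rfl⟩ : ∃ D, δhat = δ + D := ⟨δhat - δ, by abel⟩
  rw [show δ - (δ + D) = -D by abel, norm_neg]
  have hB0 : 0 ≤ B := (norm_nonneg _).trans hB
  have hb0 : 0 ≤ 2 * β / (β - 1) := div_nonneg (by linarith) (by linarith)
  have hψ0 := normCompat_nonneg (errorCone β δ)
  have hr := densityRatio_pos θ δ
  have hbasic := basic_inequality hn₂ hδ hest hgrad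
  -- By Jensen's inequality the log term dominates its linear part, so the basic inequality reduces
  -- to membership in the error set.
  have hD : D ∈ errorSet β δ := by
    have h1 := sum_mul_le_log_sum_mul_exp (ratioWeight (densityRatio θ δ) x₂)
      (fun i => inner ℝ D (suffStat (x₂ i))) (ratioWeight_nonneg hr x₂) (sum_ratioWeight hn₂ hr x₂)
    have h2 : lam * l1Norm (δ + D) ≤ lam * (l1Norm δ + 1 / β * l1Norm D) := by
      have : lam * (l1Norm δ + 1 / β * l1Norm D) = lam * l1Norm δ + lam / β * l1Norm D := by ring
      linarith
    exact le_of_mul_le_mul_left h2 hlam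
  have hDc := mem_errorCone_of_mem_errorSet hD
  have hpos : 0 ≤ (16 / (κ / 2) + 8 * Q * (1 + 2 * β / (β - 1)) * B / (κ / 2))
      * (normCompat (errorCone β δ) * lam) := by positivity
  rcases eq_or_ne D 0 with hD0 | hD0
  · simpa [hD0] using hpos
  have hDpos : 0 < ‖D‖ := norm_pos_iff.2 hD0
  -- For `s = 0` the sample size condition gives no curvature, but the error cone is then trivial.
  have hs0 : s ≠ 0 := by
    rintro rfl
    have h1 := l1Norm_le_of_mem_errorCone hβ hs hDc
    simp only [Nat.cast_zero, Real.sqrt_zero, mul_zero, zero_mul] at h1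
    refine hD0 ?_
    ext e
    have h2 : |D e| ≤ l1Norm D :=
      Finset.single_le_sum (f := fun e => |D e|) (fun _ _ => abs_nonneg _) (Finset.mem_univ e)
    exact abs_nonpos_iff.1 (h2.trans h1)
  obtain ⟨hsum, hquad⟩ := hrsc hs0
  have hDi : D ∈ isingParams p := by
    have := (isingParams p).sub_mem hest.1 hδ
    rwa [add_sub_cancel_left] at this
  have hgrow := ratioWeight_growth hn₂ hr hsum hκ.le hQ hDpos
    (hquad _ (smul_mem_errorCone (inv_nonneg.2 hDpos.le) hDc)
      ((isingParams p).smul_mem _ hDi)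
      (by rw [norm_smul, norm_inv, norm_norm, inv_mul_cancel₀ hDpos.ne']))
  exact norm_le_of_growth hβ (half_pos hκ) hQ hlam.le hB hD hDpos (by linarith)

/-- Both averages are compared with a common centre `m`. The factor `1 *` puts the first sample in
the weighted form with `r = 1`, so one tail bound serves both. -/
lemma gradient_le_of_weighted {n₁ n₂ : ℕ} (hn₁ : 0 < n₁) (hn₂ : 0 < n₂) {x₁ : Fin n₁ → Config p}
    {x₂ : Fin n₂ → Config p} {r : Config p → ℝ} (hr : ∀ x, 0 < r x) {e : Fin p × Fin p} {m t : ℝ}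
    (h₁ : |∑ i, 1 * (suffStat (x₁ i) e - m)| ≤ t * ∑ _i : Fin n₁, 1)
    (h₂ : |∑ i, r (x₂ i) * (suffStat (x₂ i) e - m)| ≤ t * ∑ i, r (x₂ i)) :
    |-(1 / (n₁ : ℝ)) * ∑ i, suffStat (x₁ i) e + ∑ i, ratioWeight r x₂ i * suffStat (x₂ i) e|
      ≤ 2 * t := by
  have hn : (0 : ℝ) < n₁ := by exact_mod_cast hn₁
  have hS := sum_ratio_pos hn₂ hr x₂
  set S := ∑ i, r (x₂ i) with hSdef
  have e1 : ∑ i, 1 * (suffStat (x₁ i) e - m) = n₁ * (1 / (n₁ : ℝ) * ∑ i, suffStat (x₁ i) e - m) := by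
    simp only [one_mul, Finset.sum_sub_distrib, Finset.sum_const, Finset.card_univ,
      Fintype.card_fin, nsmul_eq_mul]
    field_simp
  have e2 : ∑ i, r (x₂ i) * (suffStat (x₂ i) e - m)
      = S * (∑ i, ratioWeight r x₂ i * suffStat (x₂ i) e - m) := by
    rw [mul_sub, Finset.mul_sum]
    simp only [mul_sub, Finset.sum_sub_distrib, ← Finset.sum_mul, ← hSdef]
    congr 1
    refine Finset.sum_congr rfl fun i _ => ?_
    rw [ratioWeight, ← hSdef]; field_simp
  rw [e1, abs_mul, abs_of_pos hn, mul_comm t] at h₁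
  rw [e2, abs_mul, abs_of_pos hS, mul_comm t] at h₂
  simp only [Finset.sum_const, Finset.card_univ, Fintype.card_fin, nsmul_eq_mul, mul_one] at h₁
  have h3 := abs_le.1 (le_of_mul_le_mul_left h₁ hn)
  have h4 := abs_le.1 (le_of_mul_le_mul_left h₂ hS)
  rw [abs_le]
  constructor <;> linarith [h3.1, h3.2, h4.1, h4.2]

/-- The truncated quadratic is bounded below on the error cone, on the event where it deviates
little from its mean over the net. -/
lemma truncated_rsc_of_net {β M κ Q κ₀ γ : ℝ} {s n N : ℕ} (hβ : 1 < β) (hp : 0 < p) (hn : 0 < n)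
    (hs0 : s ≠ 0) (hN0 : 0 < N) (hQ : 0 < Q) (hγ : 0 < γ) (hγκ : 8 * γ ≤ κ₀)
    (hN : 8 * (2 * β / (β - 1)) ^ 2 * Q ^ 4 ≤ N * γ ^ 2) {θ₁ θ₂ : PairSpace p}
    (hs : l0Norm (θ₁ - θ₂) ≤ s)
    (hpop : ∀ g : Config p → ℝ, isingExp θ₂ (fun x => g x ^ 4) ≤ M →
      (∀ m, κ ≤ isingExp θ₂ (fun x => densityRatio θ₂ (θ₁ - θ₂) x * (g x - m) ^ 2)) →
      ∀ m, κ₀ ≤ isingExp θ₂ (fun x => min (densityRatio θ₂ (θ₁ - θ₂) x) Q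
        * min ((g x - m) ^ 2) (Q ^ 2)))
    (hM : ∀ u ∈ errorCone β (θ₁ - θ₂), u ∈ isingParams p →
        isingExp θ₂ (fun x => (inner ℝ u (suffStat x)
          - isingExp θ₂ (fun y => inner ℝ u (suffStat y))) ^ 4) ≤ M * ‖u‖ ^ 4)
    (hvar : ∀ u ∈ errorCone β (θ₁ - θ₂), u ∈ isingParams p →
        κ * ‖u‖ ^ 2 ≤ isingVar θ₁ (fun x => inner ℝ u (suffStat x)))
    {x : Fin n → Config p}
    (hnet : ∀ e : Fin (N * s) → (Fin p × Fin p) × Bool,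
      isingExp θ₂ (truncSq Q (densityRatio θ₂ (θ₁ - θ₂))
          (sparseStat (2 * (2 * β / (β - 1) * √(s : ℝ))) e)) - γ
        ≤ 1 / (n : ℝ) * ∑ i, truncSq Q (densityRatio θ₂ (θ₁ - θ₂))
          (sparseStat (2 * (2 * β / (β - 1) * √(s : ℝ))) e) (x i))
    {u : PairSpace p} (hu : u ∈ errorCone β (θ₁ - θ₂)) (hui : u ∈ isingParams p) (hu1 : ‖u‖ = 1)
    {m : ℝ} (hm : |m| ≤ l1Norm u) :
    κ₀ / 2 ≤ 1 / (n : ℝ) * ∑ i, min (densityRatio θ₂ (θ₁ - θ₂) (x i)) Q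
          * min ((inner ℝ u (suffStat (x i)) - m) ^ 2) (Q ^ 2) := by
  set r := densityRatio θ₂ (θ₁ - θ₂) with hrdef
  set b : ℝ := 2 * β / (β - 1) with hb
  have hb0 : 0 < b := div_pos (by linarith) (by linarith)
  have hs1 : (0 : ℝ) < s := by exact_mod_cast Nat.pos_of_ne_zero hs0
  obtain ⟨u', hu', hinner⟩ := exists_inner_sub_const hp u m
  have hl1 : l1Norm u ≤ b * √(s : ℝ) := by
    have := l1Norm_le_of_mem_errorCone hβ hs hu
    rwa [hu1, mul_one] at this
  have hN' : (0 : ℝ) < N := by exact_mod_cast hN0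
  have h1 := truncSq_lower_of_net hp θ₂ hn (k := N * s) (Nat.mul_pos hN0 (Nat.pos_of_ne_zero hs0)) x
    (L := 2 * (b * √(s : ℝ))) (by positivity) hQ.le hγ ?_
    (fun y => (densityRatio_pos θ₂ (θ₁ - θ₂) y).le) hnet u' (by linarith)
  · simp only [truncSq, hinner] at h1
    set c := isingExp θ₂ (fun y => inner ℝ u (suffStat y)) with hc
    -- The moment hypothesis concerns the variable centred at its `θ₂`-mean `c`, so the centre `m`
    -- becomes `m - c`.
    have h2 := hpop (fun y => inner ℝ u (suffStat y) - c)
      (by simpa [hu1] using hM u hu hui) ?_ (m - c)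
    · have h3 : ∀ y : Config p, inner ℝ u (suffStat y) - c - (m - c)
          = inner ℝ u (suffStat y) - m := fun y => by ring
      simp only [h3] at h2
      have h4 : isingExp θ₂ (fun y => min (r y) Q
          * min ((inner ℝ u (suffStat y) - m) ^ 2) (Q ^ 2))
        = isingExp θ₂ (truncSq Q r fun y => inner ℝ u (suffStat y) - m) := rfl
      rw [h4] at h2
      linarith
    · intro m'
      rw [hrdef, isingExp_densityRatio_mul]
      have h3 := hvar u hu hui
      rw [hu1, one_pow, mul_one] at h3
      refine h3.trans ((isingVar_le θ₁ _ (c + m')).trans (le_of_eq ?_))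
      congr 1
      funext y; ring
  · push_cast
    have h5 : Q ^ 4 * (2 * (2 * (b * √(s : ℝ))) ^ 2 / (N * s)) = 8 * b ^ 2 * Q ^ 4 / N := by
      rw [mul_pow, mul_pow, Real.sq_sqrt hs1.le]; field_simp; norm_num
    rw [h5, div_le_iff₀ hN']
    linarith

lemma norm_sub_le_of_isingVar {β K κ : ℝ} (hβ : 0 ≤ β) (hκ : 0 < κ) {θ₁ θ₂ : PairSpace p}
    (hθ₁ : θ₁ ∈ isingParams p) (hθ₂ : θ₂ ∈ isingParams p)
    (hs : SmoothDensityRatio K θ₂ (θ₁ - θ₂))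
    (hvar : ∀ u ∈ errorCone β (θ₁ - θ₂), u ∈ isingParams p →
        κ * ‖u‖ ^ 2 ≤ isingVar θ₁ (fun x => inner ℝ u (suffStat x))) :
    ‖θ₁ - θ₂‖ ≤ √((4 + 2 * Real.exp (K + 1)) / κ) := by
  have h1 := sq_norm_le_of_isingVar (κ := κ) θ₁ θ₂ hs ?_
  · refine Real.le_sqrt_of_sq_le ?_
    rw [le_div_iff₀ hκ]; linarith
  · have h2 := hvar _ (mem_errorCone_of_mem_errorSet (neg_mem_errorSet hβ (θ₁ - θ₂)))
      ((isingParams p).neg_mem ((isingParams p).sub_mem hθ₁ hθ₂))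
    rw [norm_neg] at h2
    refine h2.trans (le_of_eq ?_)
    have h3 : ∀ f : Config p → ℝ, isingExp θ₁ (fun x => -f x) = -isingExp θ₁ f := fun f => by
      simpa using isingExp_const_mul θ₁ (-1) f
    simp only [inner_neg_left, isingVar, h3]
    congr 1
    funext x; ring

end Assembly

/-! ### The main theorem -/

set_option maxHeartbeats 400000 in
theorem mainTheorem4 (β K M κ a : ℝ) (hβ : 1 < β) (hK : 0 < K) (hM : 0 < M) (hκ : 0 < κ)
    (ha : 0 < a) :
    ∃ c > 0, ∃ η₁ > 0, ∃ C > 0, ∀ (p s : ℕ) (θ₁ θ₂ : PairSpace p),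
      θ₁ ∈ isingParams p → θ₂ ∈ isingParams p →
      l0Norm (θ₁ - θ₂) ≤ s →
      SmoothDensityRatio K θ₂ (θ₁ - θ₂) →
      (∀ u ∈ errorCone β (θ₁ - θ₂), u ∈ isingParams p →
        isingExp θ₂ (fun x => (inner ℝ u (suffStat x)
          - isingExp θ₂ (fun y => inner ℝ u (suffStat y))) ^ 4) ≤ M * ‖u‖ ^ 4) →
      (∀ u ∈ errorCone β (θ₁ - θ₂), u ∈ isingParams p →
        κ * ‖u‖ ^ 2 ≤ isingVar θ₁ (fun x => inner ℝ u (suffStat x))) →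
      (2 ≤ β → normCompat (errorCone β (θ₁ - θ₂)) ≤ 4 * √(s : ℝ)) ∧
      ∀ (n₁ n₂ : ℕ), 0 < n₁ → 0 < n₂ → c * s * Real.log p < n₂ →
        ∀ (Ω : Type*) [MeasurableSpace Ω] (μ : Measure Ω) [IsProbabilityMeasure μ]
          (X₁ : Fin n₁ → Ω → Config p) (X₂ : Fin n₂ → Ω → Config p),
          IsIsingSample μ θ₁ θ₂ X₁ X₂ →
          ∀ η lam : ℝ, η₁ ≤ η → lam = η * √(Real.log p / (min n₁ n₂ : ℕ)) →
            1 - (p : ℝ) ^ (-a) ≤ μ.real {ω | ∀ δhat : PairSpace p,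
              IsEstimator lam (fun i => X₁ i ω) (fun i => X₂ i ω) δhat →
                ‖(θ₁ - θ₂) - δhat‖ ≤ C * (normCompat (errorCone β (θ₁ - θ₂)) * lam / κ) ∧
                ‖(θ₁ - θ₂) - δhat‖ ≤ C * η * √(s * Real.log p / (min n₁ n₂ : ℕ))} := by
  obtain ⟨Q, hQ, κ₀, hκ₀, hpop⟩ :=
    exists_truncated_lower_bound (Real.exp (K + 1)) M κ (Real.exp_pos _) hM hκ
  set b : ℝ := 2 * β / (β - 1) with hb
  have hb0 : 0 < b := div_pos (by linarith) (by linarith)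
  set γ : ℝ := min (κ₀ / 8) 1 with hγ
  have hγ0 : 0 < γ := by positivity
  have hγ1 : γ ≤ 1 := min_le_right _ _
  have hγκ : 8 * γ ≤ κ₀ := by linarith [min_le_left (κ₀ / 8) 1]
  set A : ℝ := 2 * (Real.exp 4 * Real.exp (K * 8 ^ 2 + 8)) with hA
  have hA1 : 1 ≤ A := by
    have h1 : (1 : ℝ) ≤ Real.exp 4 := Real.one_le_exp (by norm_num)
    have h2 : (1 : ℝ) ≤ Real.exp (K * 8 ^ 2 + 8) := Real.one_le_exp (by positivity)
    nlinarith
  have hA0 : 0 < A := by linarith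
  set A' : ℝ := 8 * Real.exp (2 * Q ^ 3) with hA'
  have hA'0 : 0 < A' := by positivity
  obtain ⟨N, hN⟩ := exists_nat_ge (8 * b ^ 2 * Q ^ 4 / γ ^ 2)
  have hN0 : 0 < N := by
    have : (0 : ℝ) < N := lt_of_lt_of_le (by positivity) hN
    exact_mod_cast this
  rw [div_le_iff₀ (by positivity)] at hN
  set B : ℝ := √((4 + 2 * Real.exp (K + 1)) / κ) with hB
  set C₁ : ℝ := 16 / (κ₀ / 2 / 2) + 8 * Q * (1 + b) * B / (κ₀ / 2 / 2) with hC₁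
  have hC₁0 : 0 < C₁ := by positivity
  -- In `c`, the first summand pays for the net and the second for the total weight. In `C`, the
  -- terms `C₁ κ` and `C₁ b` serve the first and the second bound.
  refine ⟨(3 * N + a + 2) * A' / γ ^ 2 + 4 * A * (a + 2), by positivity,
    2 * β * √(4 * A * (a + 5)), by positivity, C₁ * κ + C₁ * b, by positivity, ?_⟩
  intro p s θ₁ θ₂ hθ₁ hθ₂ hs hsm hfour hvar
  refine ⟨fun hβ2 => (normCompat_errorCone_le hβ hs).trans
    (mul_le_mul_of_nonneg_right ?_ (Real.sqrt_nonneg _)), ?_⟩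
  · rw [div_le_iff₀ (by linarith)]; linarith
  intro n₁ n₂ hn₁ hn₂ hc Ω _ μ _ X₁ X₂ hX η lam hη hlam
  have hη0 : 0 < η := lt_of_lt_of_le (by positivity) hη
  set ψ := normCompat (errorCone β (θ₁ - θ₂)) with hψ
  have hψ0 : 0 ≤ ψ := normCompat_nonneg _
  have hlam0 : 0 ≤ lam := by rw [hlam]; positivity
  -- For `p = 0`, `0 ^ (-a) = 0` and probability one is required, but the parameter space is a
  -- point; for `p = 1` the claimed probability is 0.
  rcases Nat.lt_or_ge p 2 with hp2 | hp2
  · obtain rfl | rfl : p = 0 ∨ p = 1 := by lia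
    · have hall : {ω | ∀ δhat : PairSpace 0,
          IsEstimator lam (fun i => X₁ i ω) (fun i => X₂ i ω) δhat →
            ‖(θ₁ - θ₂) - δhat‖ ≤ (C₁ * κ + C₁ * b) * (ψ * lam / κ) ∧
            ‖(θ₁ - θ₂) - δhat‖ ≤ (C₁ * κ + C₁ * b) * η *
              √(s * Real.log (0 : ℕ) / (min n₁ n₂ : ℕ))} = Set.univ := by
        ext ω
        simp only [Set.mem_ofPred_eq, Set.mem_univ, iff_true]
        intro δhat _
        rw [Subsingleton.elim (θ₁ - θ₂ - δhat) 0, norm_zero]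
        exact ⟨by positivity, by positivity⟩
      rw [hall, probReal_univ, Nat.cast_zero, Real.zero_rpow (by linarith)]
      norm_num
    · simp
  set l := Real.log p with hl
  have hp0 : (0 : ℝ) < p := by positivity
  have hp2' : (2 : ℝ) ≤ p := by exact_mod_cast hp2
  have hl0 : 0 < l := Real.log_pos (by linarith)
  have hpl : (p : ℝ) = Real.exp l := (Real.exp_log hp0).symm
  have hpa : (p : ℝ) ^ (-a) = Real.exp (-a * l) := by
    rw [Real.rpow_def_of_pos hp0, mul_comm]
  set r := densityRatio θ₂ (θ₁ - θ₂) with hr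
  have hr0 : ∀ x, 0 < r x := densityRatio_pos _ _
  have hr1 : isingExp θ₂ r = 1 := isingExp_densityRatio _ _
  have hrA : 2 * (Real.exp 4 * isingExp θ₂ (fun x => Real.exp (8 * r x))) ≤ A :=
    mul_le_mul_of_nonneg_left (mul_le_mul_of_nonneg_left (hsm.exp_mul_le 8) (Real.exp_pos _).le)
      zero_le_two
  have hi₁ : iIndepFun X₁ μ := hX.indep.precomp (g := Sum.inl) Sum.inl_injective
  have hi₂ : iIndepFun X₂ μ := hX.indep.precomp (g := Sum.inr) Sum.inr_injective
  set n : ℕ := min n₁ n₂ with hn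
  have hnpos : (0 : ℝ) < n := by exact_mod_cast lt_min hn₁ hn₂
  -- Of `a + 5`, three units absorb the `2p² ≤ p³` signed coordinates and `a + 2` remain for the
  -- tail.
  set t : ℝ := √(4 * A * (a + 5)) * √(l / n) with ht
  have ht0 : 0 ≤ t := by positivity
  have htlam : 2 * t ≤ lam / β := by
    rw [le_div_iff₀ (by linarith), hlam]
    have := mul_le_mul_of_nonneg_right hη (Real.sqrt_nonneg (l / n))
    rw [ht]; linarith
  have htn : ∀ n' : ℕ, n ≤ n' → (a + 5) * l ≤ n' * t ^ 2 / (4 * A) := by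
    intro n' hn'
    have h1 : (n : ℝ) ≤ n' := by exact_mod_cast hn'
    rw [ht, mul_pow, Real.sq_sqrt (by positivity), Real.sq_sqrt (by positivity)]
    have h2 : (n' : ℝ) * (4 * A * (a + 5) * (l / n)) / (4 * A) = (a + 5) * l * (n' / n) := by
      field_simp
    rw [h2]
    exact le_mul_of_one_le_right (by positivity) ((one_le_div hnpos).2 h1)
  have htwo : 2 * (p : ℝ) ^ 2 ≤ Real.exp (3 * l) := by
    have : Real.exp (3 * l) = (p : ℝ) ^ 3 := by
      rw [hpl, ← Real.exp_nat_mul]; norm_num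
    rw [this]; nlinarith [sq_nonneg (p : ℝ)]
  have hgrad_tail : ∀ n' : ℕ, n ≤ n' →
      2 * (p : ℝ) ^ 2 * Real.exp (-(n' * t ^ 2 / (4 * A))) ≤ Real.exp (-(a + 2) * l) := by
    intro n' hn'
    refine (mul_le_mul_of_nonneg_right htwo (Real.exp_pos _).le).trans ?_
    rw [← Real.exp_add]
    exact Real.exp_le_exp.2 (by linarith [htn n' hn'])
  set m : Fin p × Fin p → ℝ := fun e => isingExp θ₂ (fun x => r x * suffStat x e) with hm
  set E₁ : Set Ω := {ω | ¬ ∀ e, |∑ i, 1 * (suffStat (X₁ i ω) e - m e)|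
    ≤ t * ∑ _i : Fin n₁, 1} with hE₁
  set E₂ : Set Ω := {ω | ¬ ∀ e, |∑ i, r (X₂ i ω) * (suffStat (X₂ i ω) e - m e)|
    ≤ t * ∑ i, r (X₂ i ω)} with hE₂
  have hE₁p : μ.real E₁ ≤ Real.exp (-(a + 2) * l) := by
    have h := measureReal_weighted_suffStat_le hX.measurable₁ hX.law₁ hi₁ (r := fun _ => 1)
      (fun _ => zero_le_one) (isingExp_const _ _) (A := A) (t := t) ?_ ht0
    · refine le_trans (le_of_eq ?_) (h.trans (hgrad_tail n₁ (min_le_left _ _)))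
      have h2 : ∀ e, isingExp θ₁ (fun x => 1 * suffStat x e) = m e := by
        intro e
        rw [hm, hr]
        simp only [isingExp_densityRatio_mul, one_mul]
      simp only [h2, hE₁]
    · rw [isingExp_const]
      refine mul_le_mul_of_nonneg_left (mul_le_mul_of_nonneg_left ?_ (Real.exp_pos _).le)
        zero_le_two
      exact Real.exp_le_exp.2 (by linarith)
  have hE₂p : μ.real E₂ ≤ Real.exp (-(a + 2) * l) :=
    (measureReal_weighted_suffStat_le hX.measurable₂ hX.law₂ hi₂ (fun x => (hr0 x).le) hr1 hrA
      ht0).trans (hgrad_tail n₂ (min_le_right _ _))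
  obtain ⟨E₃, hE₃p, hE₃⟩ : ∃ E₃ : Set Ω, μ.real E₃ ≤ 2 * Real.exp (-(a + 2) * l) ∧
      ∀ ω ∉ E₃, s ≠ 0 → ∑ i, r (X₂ i ω) ≤ 2 * n₂ ∧
        ∀ u ∈ errorCone β (θ₁ - θ₂), u ∈ isingParams p → ‖u‖ = 1 → ∀ m : ℝ, |m| ≤ l1Norm u →
          κ₀ / 2 ≤ 1 / (n₂ : ℝ) * ∑ i, min (r (X₂ i ω)) Q
            * min ((inner ℝ u (suffStat (X₂ i ω)) - m) ^ 2) (Q ^ 2) := by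
    rcases eq_or_ne s 0 with hs0 | hs0
    · exact ⟨∅, by rw [measureReal_empty]; positivity, fun _ _ h => absurd hs0 h⟩
    have hs1 : (1 : ℝ) ≤ s := by exact_mod_cast Nat.one_le_iff_ne_zero.2 hs0
    have hn₂A : (a + 2) * l ≤ n₂ / (4 * A) := by
      rw [le_div_iff₀ (by positivity)]
      have h1 : 0 ≤ (3 * N + a + 2) * A' / γ ^ 2 * s * l := by positivity
      have h2 : 4 * A * (a + 2) * l * 1 ≤ 4 * A * (a + 2) * l * s :=
        mul_le_mul_of_nonneg_left hs1 (by positivity)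
      linarith
    have hn₂A' : (3 * (N * s) + (a + 2)) * l ≤ n₂ * γ ^ 2 / A' := by
      rw [le_div_iff₀ hA'0]
      have h1 : 0 ≤ 4 * A * (a + 2) * s * l := by positivity
      have h2 : (3 * N + a + 2) * A' / γ ^ 2 * s * l ≤ n₂ := by linarith
      have h3 := mul_le_mul_of_nonneg_right h2 (sq_nonneg γ)
      have h4 : (3 * N + a + 2) * A' / γ ^ 2 * s * l * γ ^ 2 = (3 * N + a + 2) * A' * s * l := by
        field_simp
      rw [h4] at h3
      have h5 : (a + 2) * A' * l * 1 ≤ (a + 2) * A' * l * s :=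
        mul_le_mul_of_nonneg_left hs1 (by positivity)
      linarith
    have hP₁ := measureReal_sum_weight_gt_le hX.measurable₂ hX.law₂ hi₂ (fun x => (hr0 x).le)
      hr1 hrA hA1
    have hP₂ := measureReal_net_le hn₂ hX.measurable₂ hX.law₂ hi₂ (N * s)
      (L := 2 * (b * √(s : ℝ))) hQ.le hγ0 hγ1 (fun x => (hr0 x).le)
    refine ⟨_, (measureReal_union_le _ _).trans ((add_le_add hP₁ hP₂).trans ?_), ?_⟩
    · have h1 : Real.exp (-(n₂ / (4 * A))) ≤ Real.exp (-(a + 2) * l) :=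
        Real.exp_le_exp.2 (by linarith)
      have h2 : (2 * (p : ℝ) ^ 2) ^ (N * s) * Real.exp (-(n₂ * γ ^ 2 / A'))
          ≤ Real.exp (-(a + 2) * l) := by
        refine (mul_le_mul_of_nonneg_right (pow_le_pow_left₀ (by positivity) htwo (N * s))
          (Real.exp_pos _).le).trans ?_
        rw [← Real.exp_nat_mul, ← Real.exp_add]
        refine Real.exp_le_exp.2 ?_
        push_cast
        linarith
      linarith
    · intro ω hω _
      simp only [Set.mem_union, Set.mem_ofPred_eq, not_or, not_not] at hω
      refine ⟨hω.1, fun u hu hui hu1 m' hm' => ?_⟩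
      exact truncated_rsc_of_net (x := fun i => X₂ i ω) hβ (by lia) hn₂ hs0 hN0 hQ hγ0 hγκ hN hs
        (fun g hg1 hg2 => hpop p θ₂ r g (fun x => (hr0 x).le) hr1
          (by simpa using hsm.exp_mul_le 1) hg1 hg2) hfour hvar hω.2 hu hui hu1 hm'
  have hδB : ‖θ₁ - θ₂‖ ≤ B := norm_sub_le_of_isingVar (by linarith) hκ hθ₁ hθ₂ hsm hvar
  set G : Set Ω := {ω | ∀ δhat : PairSpace p,
    IsEstimator lam (fun i => X₁ i ω) (fun i => X₂ i ω) δhat →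
      ‖(θ₁ - θ₂) - δhat‖ ≤ (C₁ * κ + C₁ * b) * (ψ * lam / κ) ∧
      ‖(θ₁ - θ₂) - δhat‖ ≤ (C₁ * κ + C₁ * b) * η * √(s * l / n)} with hG
  have hcover : (Set.univ : Set Ω) ⊆ G ∪ (E₁ ∪ (E₂ ∪ E₃)) := by
    intro ω _
    by_contra hω
    simp only [Set.mem_union, not_or] at hω
    obtain ⟨hωG, hω₁, hω₂, hω₃⟩ := hω
    refine hωG fun δhat hest => ?_
    have hlampos : 0 < lam := by
      rw [hlam]
      have : 0 < √(l / n) := Real.sqrt_pos.2 (by positivity)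
      positivity
    have hgrad : ∀ e, |-(1 / (n₁ : ℝ)) * ∑ i, suffStat (X₁ i ω) e
        + ∑ i, ratioWeight r (fun i => X₂ i ω) i * suffStat (X₂ i ω) e| ≤ lam / β := fun e =>
      (gradient_le_of_weighted hn₁ hn₂ hr0 (not_not.1 hω₁ e) (not_not.1 hω₂ e)).trans htlam
    have hmain := norm_sub_le_of_isEstimator hβ (half_pos hκ₀) hQ hlampos hn₂
      ((isingParams p).sub_mem hθ₁ hθ₂) hs hδB hest hgrad (hE₃ ω hω₃)
    constructor
    · refine hmain.trans ?_
      have h1 : (C₁ * κ + C₁ * b) * (ψ * lam / κ) = C₁ * (ψ * lam) + C₁ * b * (ψ * lam / κ) := by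
        field_simp
      rw [h1]
      exact le_add_of_nonneg_right (by positivity)
    · refine hmain.trans ?_
      have h1 : ψ ≤ b * √(s : ℝ) := normCompat_errorCone_le hβ hs
      have h2 : √(s * l / n) = √(s : ℝ) * √(l / n) := by
        rw [mul_div_assoc, Real.sqrt_mul (Nat.cast_nonneg _)]
      have h3 : C₁ * (ψ * lam) ≤ C₁ * (b * √(s : ℝ) * lam) :=
        mul_le_mul_of_nonneg_left (mul_le_mul_of_nonneg_right h1 hlam0) hC₁0.le
      refine h3.trans ?_
      rw [h2, hlam]
      have h4 : 0 ≤ C₁ * κ * η * (√(s : ℝ) * √(l / n)) := by positivity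
      linarith
  have hfinal : 1 ≤ μ.real G + (Real.exp (-(a + 2) * l) + (Real.exp (-(a + 2) * l)
      + 2 * Real.exp (-(a + 2) * l))) := by
    have h1 := measureReal_mono (μ := μ) hcover (measure_ne_top _ _)
    rw [probReal_univ] at h1
    have h2 := measureReal_union_le (μ := μ) G (E₁ ∪ (E₂ ∪ E₃))
    have h3 := measureReal_union_le (μ := μ) E₁ (E₂ ∪ E₃)
    have h4 := measureReal_union_le (μ := μ) E₂ E₃
    linarith
  -- The exceptional events cost four terms `p ^ (-(a + 2))`, and `4 ≤ p²`.
  have hfour_le : 4 * Real.exp (-(a + 2) * l) ≤ (p : ℝ) ^ (-a) := by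
    rw [hpa]
    have h1 : Real.exp (-(a + 2) * l) * (p : ℝ) ^ 2 = Real.exp (-a * l) := by
      rw [hpl, ← Real.exp_nat_mul, ← Real.exp_add]
      congr 1; push_cast; ring
    rw [← h1, mul_comm]
    exact mul_le_mul_of_nonneg_left (by nlinarith) (Real.exp_pos _).le
  linarith
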